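/- Let $N\ge n\ge 1$ and $m,q\ge 1$ be integers. Let $H_1,\dots,H_q$ be hyperplanes in $\mathbb{P}^n$ in general position (any at most $n+1$ of their defining linear forms are linearly independent over $\mathbb{C}$), and let $H'_1,\dots,H'_q$ be hyperplanes in $\mathbb{P}^N$ in general position (any at most $N+1$ of their defining linear forms are linearly independent). Let $f:\mathbb{C}^m\to\mathbb{P}^n$ and $g:\mathbb{C}^m\to\mathbb{P}^N$ be meromorphic maps such that, for all $1\le j\le q$, $f(\mathbb{C}^m)\not\subseteq H_j$, $g(\mathbb{C}^m)\not\subseteq H'_j$, and the pullback divisors coincide: $f^*(H_j)=g^*(H'_j)$. (If $(f_0,\dots,f_n)$ is a reduced representation of $f$, that is, $f=[f_0:\dots:f_n]$ with holomorphic $f_i$ whose common zero set has codimension at least $2$, and $H=\{a_0x_0+\dots+a_nx_n=0\}$, then $f^*(H)$ is the zero divisor of $a_0f_0+\dots+a_nf_n$.) Suppose that $g(\mathbb{C}^m)$ is not contained in any hypersurface of degree $\le 2$ in $\mathbb{P}^N$ and that $$q\ \ge\ \max\Big\{3n+2,\ N+\tfrac32 n+\tfrac32\Big\}.$$ Then $N=n$,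 and there are a projective linear transformation $L$ of $\mathbb{P}^n$ and $n+2$ distinct indices $k_1,\dots,k_{n+2}\in\{1,\dots,q\}$ such that $f=L(g)$ and $$L(H'_{k_i})=H_{k_i},\qquad 1\le i\le n+2.$$ -/

import Mathlib

namespace UniquenessMero

open Topology

/-- The affine space `ℂ^m`. -/
abbrev Cn (m : ℕ) : Type := Fin m → ℂ

/-- The complex projective space `ℙ^n`, the space of lines of `ℂ^{n+1}`. -/
abbrev CP (n : ℕ) : Type := Projectivization ℂ (Fin (n + 1) → ℂ)

/-- An analytic subset `A` of `ℂ^m` has codimension at least two at its point `z`: some affine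
complex plane through `z` meets `A` near `z` only in `z`. (The codimension of an analytic set at
`z` is the largest dimension of an affine subspace through `z` in which `z` is an isolated point
of the section.) -/
def CodimGETwoAt {m : ℕ} (A : Set (Cn m)) (z : Cn m) : Prop :=
  ∃ P : Submodule ℂ (Cn m), Module.finrank ℂ P = 2 ∧
    ∀ᶠ w in 𝓝 z, w ∈ A → w - z ∈ P → w = z

/-- `F = (F₀, …, Fₙ)` is a reduced representation near `z` of the map `f : ℂ^m ∖ I → ℙ^n`:
the `F_i` are holomorphic near `z`, their common zero set near `z` is `I`, and
`f = [F₀ : … : Fₙ]` near `z` outside `I`. -/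
def IsReducedRepAt {m n : ℕ} (I : Set (Cn m)) (f : ∀ z : Cn m, z ∉ I → CP n)
    (z : Cn m) (F : Cn m → Fin (n + 1) → ℂ) : Prop :=
  AnalyticAt ℂ F z ∧
    ∀ᶠ w in 𝓝 z, (w ∈ I ↔ F w = 0) ∧
      ∀ (hw : w ∉ I) (hF : F w ≠ 0), f w hw = Projectivization.mk ℂ (F w) hF

/-- A meromorphic map of `ℂ^m` into `ℙ^n`: a map defined outside its indeterminacy locus, an
analytic subset of codimension at least two, which has a reduced representation by holomorphic
functions in a neighbourhood of every point of `ℂ^m`. -/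
structure MeroMap (m n : ℕ) where
  /-- The indeterminacy locus. -/
  indet : Set (Cn m)
  /-- The map outside the indeterminacy locus. -/
  toFun : ∀ z : Cn m, z ∉ indet → CP n
  codim_indet : ∀ z ∈ indet, CodimGETwoAt indet z
  exists_rep : ∀ z : Cn m, ∃ F : Cn m → Fin (n + 1) → ℂ, IsReducedRepAt indet toFun z F

/-- The image `f(ℂ^m)`. -/
def MeroMap.image {m n : ℕ} (f : MeroMap m n) : Set (CP n) :=
  {p | ∃ (z : Cn m) (hz : z ∉ f.indet), f.toFun z hz = p}

/-- The hyperplane of `ℙ^n` defined by the linear form `a₀X₀ + … + aₙXₙ`. -/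
def hyperplane {n : ℕ} (a : Fin (n + 1) → ℂ) : Set (CP n) :=
  {p | ∑ i, a i * p.rep i = 0}

/-- The hyperplanes defined by the linear forms `a j` are in general position: any at most `n + 1`
of the forms are linearly independent. In particular all the forms are nonzero. -/
def InGeneralPosition {n q : ℕ} (a : Fin q → Fin (n + 1) → ℂ) : Prop :=
  ∀ s : Finset (Fin q), s.card ≤ n + 1 → LinearIndependent ℂ (fun i : s => a i)

/-- The zero set in `ℙ^n` of a homogeneous polynomial. -/
def hypersurface {n : ℕ} (P : MvPolynomial (Fin (n + 1)) ℂ) : Set (CP n) :=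
  {p | MvPolynomial.eval p.rep P = 0}

/-- `f(ℂ^m)` is not contained in any hypersurface of degree at most `d` in `ℙ^n`. -/
def MeroMap.NotInHypersurfaceOfDegreeLE {m n : ℕ} (f : MeroMap m n) (d : ℕ) : Prop :=
  ∀ (k : ℕ) (P : MvPolynomial (Fin (n + 1)) ℂ), 1 ≤ k → k ≤ d → P.IsHomogeneous k → P ≠ 0 →
    ¬ f.image ⊆ hypersurface P

/-- The pullback divisor `f^*H` of the hyperplane `H` defined by the linear form `a`: the zero
divisor of the holomorphic function `(f, H) = a₀f₀ + … + aₙfₙ`, where `(f₀, …, fₙ)` is a reduced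
representation. The divisor is given by its local equations: to a point `z` it assigns the set of
all products, near `z`, of `(f, H)` and a nowhere zero holomorphic function. -/
def MeroMap.pullbackDivisor {m n : ℕ} (f : MeroMap m n) (a : Fin (n + 1) → ℂ) (z : Cn m) :
    Set (Cn m → ℂ) :=
  {φ | ∃ F : Cn m → Fin (n + 1) → ℂ, IsReducedRepAt f.indet f.toFun z F ∧
    ∃ u : Cn m → ℂ, AnalyticAt ℂ u z ∧ u z ≠ 0 ∧
      ∀ᶠ w in 𝓝 z, φ w = u w * ∑ i, a i * F w i}

/-- The projective linear map `ℙ^N → ℙ^n` induced by a linear isomorphism `ℂ^{N+1} ≃ ℂ^{n+1}`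
(for `N = n`: a projective linear transformation of `ℙ^n`). -/
noncomputable def projMap {N n : ℕ} (T : (Fin (N + 1) → ℂ) ≃ₗ[ℂ] (Fin (n + 1) → ℂ)) : CP N → CP n :=
  Projectivization.map T.toLinearMap T.injective

/-- `f = L(g)` as meromorphic maps. -/
def MeroMap.EqComp {m n N : ℕ} (f : MeroMap m n) (L : CP N → CP n) (g : MeroMap m N) : Prop :=
  f.indet = g.indet ∧
    ∀ (z : Cn m) (hf : z ∉ f.indet) (hg : z ∉ g.indet), f.toFun z hf = L (g.toFun z hg)

end UniquenessMero

namespace UniquenessMero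
open Real Filter Topology Set Metric

/-! Equality of the pullback divisors makes the quotients of the linear forms `a j ⬝ᵥ F` and `b j ⬝ᵥ
G`, up to one factor independent of `j`, nowhere vanishing entire functions `ψ j`
(`exists_entire_ratios`). For any `n + N + 2` indices the vector `(F, -uG)` is a nonzero solution of
the square system with rows `(a j | ψ j · b j)` wherever `F ≠ 0`, so its determinant vanishes
identically. Expanded by multilinearity, this is a vanishing sum of products of `ψ j` over index
sets of size `N + 1`; for distinct indices, general position makes every coefficient nonzero.

Borel's lemma, on a suitable complex line, then says that each such product equals another one up to
a constant. A real linear functional on the exponents turns this into equalities between sums of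
real numbers `x j`, where `x i = x j` forces `ψ i / ψ j` to be constant. Sort the `x j`. Comparing
the `N + 1` smallest with the `n + 1` largest, and the `n + 1` smallest with the `N + 1` largest,
produces two blocks of equal values, that is, two classes of proportional `ψ j`.

If `N = n`, the bound on `q` gives a class of `n + 2` indices. The `n + 2` forms `a j` satisfy one
relation with nonzero coefficients, which linear nondegeneracy of `g` transfers to the `b j`; so one
linear isomorphism matches all these forms and carries `g` to `f`. If `N > n`, a class of `n + 2`
contradicts general position of the `b j`, while two distinct classes with `n + 3` indices in total
force a quadric through the image of `g` (`not_two_proportional_classes`).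

Borel's lemma is proved by elimination over an algebra of entire functions of controlled growth,
followed by a Nevanlinna-type estimate: the real parts of the exponent differences are bounded by a
power of the logarithm of their own growth, hence bounded. -/

/-! ### Growth lemma and entire functions of moderate growth -/

/-- Borel's growth lemma. If `L` more than doubled at each step `x ↦ x + 1 / L x ^ 2`, then `L ≥ 2 ^
k` after `k` steps, so the steps sum to at most `2` and `L` would exceed every bound at `x₀ + 2`. -/
theorem exists_slow_growth {L : ℝ → ℝ} (hL : Monotone L) (h1 : ∀ x, 1 ≤ L x) (x₀ : ℝ) :
    ∃ x, x₀ ≤ x ∧ L (x + 1 / L x ^ 2) ≤ 2 * L x := by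
  by_contra! hcon
  let s : ℕ → ℝ := fun k => Nat.rec x₀ (fun _ x => x + 1 / L x ^ 2) k
  have hs : ∀ k, s (k + 1) = s k + 1 / L (s k) ^ 2 := fun k => rfl
  have key : ∀ k, x₀ ≤ s k ∧ (2 : ℝ) ^ k ≤ L (s k) ∧ s k ≤ x₀ + 2 - 2 / 2 ^ k := by
    intro k
    induction k with
    | zero => exact ⟨le_rfl, by simpa using h1 _, by simp [s]⟩
    | succ k ih =>
      obtain ⟨i1, i2, i3⟩ := ih
      have hpos : (0 : ℝ) < 2 ^ k := by positivity
      have hk1 : (1 : ℝ) ≤ 2 ^ k := one_le_pow₀ (by norm_num)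
      have hLpos : 0 < L (s k) := by linarith [h1 (s k)]
      have hle : 1 / L (s k) ^ 2 ≤ 1 / 2 ^ k := by
        apply one_div_le_one_div_of_le hpos
        nlinarith
      have h0 : 0 ≤ 1 / L (s k) ^ 2 := by positivity
      refine ⟨by rw [hs]; linarith, ?_, ?_⟩
      · rw [hs, pow_succ]; linarith [hcon (s k) i1]
      · have : (2 : ℝ) / 2 ^ k - 1 / 2 ^ k = 2 / 2 ^ (k + 1) := by
          rw [pow_succ]; field_simp; norm_num
        rw [hs]; linarith
  obtain ⟨k, hk⟩ := pow_unbounded_of_one_lt (L (x₀ + 2)) (one_lt_two)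
  obtain ⟨-, i2, i3⟩ := key k
  have : L (s k) ≤ L (x₀ + 2) := hL (by have : (0:ℝ) < 2 / 2 ^ k := by positivity
                                        linarith)
  linarith

/-- The comparison function `(1 + M(R)) R / (R - r)` for functions of moderate growth. -/
noncomputable def growthScale (M : ℝ → ℝ) (r R : ℝ) : ℝ := (1 + M R) * (R / (R - r))

theorem one_le_growthScale {M : ℝ → ℝ} (hM : ∀ r, 0 ≤ M r) {r R : ℝ} (hr : 1 ≤ r) (hR : r < R) :
    1 ≤ growthScale M r R := by
  have h1 : 1 ≤ R / (R - r) := by rw [le_div_iff₀] <;> linarith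
  have h2 := hM R
  unfold growthScale
  nlinarith

/-- The entire functions whose growth is polynomially bounded in terms of `M`. -/
def ModerateGrowth (M : ℝ → ℝ) (a : ℂ → ℂ) : Prop :=
  Differentiable ℂ a ∧ ∃ (C : ℝ) (D : ℕ), 0 ≤ C ∧
    ∀ r R, 1 ≤ r → r < R → ∀ z : ℂ, ‖z‖ ≤ r → ‖a z‖ ≤ C * growthScale M r R ^ D

/-- The algebra of entire functions of moderate growth. -/
def moderateGrowth (M : ℝ → ℝ) (hM : ∀ r, 0 ≤ M r) : Subalgebra ℂ (ℂ → ℂ) where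
  carrier := {a | ModerateGrowth M a}
  mul_mem' := by
    rintro a b ⟨ha, C, D, hC, h⟩ ⟨hb, C', D', hC', h'⟩
    refine ⟨ha.mul hb, C * C', D + D', by positivity, fun r R hr hR z hz => ?_⟩
    have := one_le_growthScale hM hr hR
    rw [Pi.mul_apply, norm_mul]
    calc _ ≤ (C * growthScale M r R ^ D) * (C' * growthScale M r R ^ D') := by
          gcongr
          exacts [h r R hr hR z hz, h' r R hr hR z hz]
      _ = _ := by ring
  add_mem' := by
    rintro a b ⟨ha, C, D, hC, h⟩ ⟨hb, C', D', hC', h'⟩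
    refine ⟨ha.add hb, C + C', D + D', by positivity, fun r R hr hR z hz => ?_⟩
    have := one_le_growthScale hM hr hR
    rw [Pi.add_apply]
    calc _ ≤ C * growthScale M r R ^ D + C' * growthScale M r R ^ D' :=
          (norm_add_le _ _).trans (add_le_add (h r R hr hR z hz) (h' r R hr hR z hz))
      _ ≤ C * growthScale M r R ^ (D + D') + C' * growthScale M r R ^ (D + D') := by
          gcongr <;> first | exact this | omega
      _ = _ := by ring
  algebraMap_mem' c := by
    refine ⟨differentiable_const _, ‖c‖, 0, by positivity, fun r R hr hR z hz => ?_⟩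
    simp

theorem moderateGrowth_differentiable {M : ℝ → ℝ} {hM : ∀ r, 0 ≤ M r} {a : ℂ → ℂ}
    (ha : a ∈ moderateGrowth M hM) : Differentiable ℂ a := ha.1

/-- Cauchy's estimate on a disc of radius `(R - r) / 2`. Moving `r` to the midpoint doubles the
growth scale, and the inverse radius costs one further power because `R ≥ 1`. -/
theorem moderateGrowth_deriv {M : ℝ → ℝ} {hM : ∀ r, 0 ≤ M r} {a : ℂ → ℂ}
    (ha : a ∈ moderateGrowth M hM) : deriv a ∈ moderateGrowth M hM := by
  obtain ⟨ha, C, D, hC, h⟩ := ha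
  refine ⟨ha.deriv, 2 ^ (D + 1) * C, D + 1, by positivity, fun r R hr hR z hz => ?_⟩
  have hm : growthScale M ((r + R) / 2) R = 2 * growthScale M r R := by
    have : R - r ≠ 0 := by linarith
    have : R - (r + R) / 2 ≠ 0 := by linarith
    have e : R / (R - (r + R) / 2) = 2 * (R / (R - r)) := by
      rw [div_eq_iff this]; field_simp; ring
    unfold growthScale
    rw [e]; ring
  have hpos : 0 < (R - r) / 2 := by linarith
  have h1 := one_le_growthScale hM hr hR
  have h2 : 1 / ((R - r) / 2) ≤ 2 * growthScale M r R := by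
    have e : 1 / ((R - r) / 2) = 2 * (1 * (1 / (R - r))) := by field_simp
    have : 0 < R - r := by linarith
    rw [e]
    have h3 : 1 / (R - r) ≤ R / (R - r) := by gcongr; linarith
    have h4 : (0 : ℝ) ≤ R / (R - r) := div_nonneg (by linarith) this.le
    unfold growthScale
    nlinarith [mul_nonneg (hM R) h4]
  have := Complex.norm_deriv_le_of_forall_mem_sphere_norm_le hpos (ha.diffContOnCl (s := ball z _))
    (C := C * growthScale M ((r + R) / 2) R ^ D) (fun w hw => by
      apply h _ R (by linarith) (by linarith)
      have : ‖w - z‖ = (R - r) / 2 := by simpa [dist_eq_norm] using hw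
      have := norm_add_le (w - z) z
      rw [sub_add_cancel] at this
      linarith)
  calc _ ≤ _ := this
    _ = C * growthScale M ((r + R) / 2) R ^ D * (1 / ((R - r) / 2)) := by ring
    _ ≤ C * (2 * growthScale M r R) ^ D * (2 * growthScale M r R) := by rw [hm]; gcongr
    _ = _ := by ring

/-! ### Elimination -/

theorem entire_eq_zero_of_mul_eq_zero {a b : ℂ → ℂ} (hb : Differentiable ℂ b)
    (ha : Differentiable ℂ a) (ha0 : a ≠ 0) (h : a * b = 0) : b = 0 := by
  obtain ⟨z, hz⟩ := Function.ne_iff.mp ha0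
  refine AnalyticOnNhd.eq_of_eventuallyEq (z₀ := z) (fun x _ => hb.analyticAt x)
    (fun x _ => analyticAt_const) ?_
  filter_upwards [ha.continuous.continuousAt.eventually_ne hz] with w hw
  exact (mul_eq_zero.mp (congrFun h w)).resolve_left hw

theorem entire_mul_ne_zero {a b : ℂ → ℂ} (ha : Differentiable ℂ a) (hb : Differentiable ℂ b)
    (ha0 : a ≠ 0) (hb0 : b ≠ 0) : a * b ≠ 0 :=
  fun h => hb0 (entire_eq_zero_of_mul_eq_zero hb ha ha0 h)

/-- The quotient `g / a` has derivative zero near a point where `a ≠ 0`; the identity theorem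
propagates the proportionality. -/
theorem exists_eq_smul_of_wronskian {a g : ℂ → ℂ} (ha : Differentiable ℂ a)
    (hg : Differentiable ℂ g) (ha0 : a ≠ 0) (h : a * deriv g = deriv a * g) :
    ∃ c : ℂ, g = c • a := by
  obtain ⟨z, hz⟩ := Function.ne_iff.mp ha0
  obtain ⟨ε, hε, hball⟩ := Metric.eventually_nhds_iff_ball.mp
    (ha.continuous.continuousAt.eventually_ne hz)
  have hd : ∀ w ∈ ball z ε, HasDerivAt (fun w => g w / a w) 0 w := by
    intro w hw
    have e := congrFun h w
    simp only [Pi.mul_apply] at e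
    have := (hg w).hasDerivAt.fun_div (ha w).hasDerivAt (hball w hw)
    rwa [mul_comm (deriv g w), e, mul_comm (g w), sub_self, zero_div] at this
  obtain ⟨c, hc⟩ := isOpen_ball.exists_is_const_of_deriv_eq_zero
    (convex_ball z ε).isPreconnected (fun w hw => (hd w hw).differentiableAt.differentiableWithinAt)
    (fun w hw => (hd w hw).deriv)
  refine ⟨c, AnalyticOnNhd.eq_of_eventuallyEq (z₀ := z) (fun x _ => hg.analyticAt x)
    (fun x _ => (ha.const_smul c).analyticAt x) ?_⟩
  filter_upwards [ball_mem_nhds z hε] with w hw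
  have := hc w hw
  rw [div_eq_iff (hball w hw)] at this
  simpa using this

/-- The quotient `e^{u} / e^{v}` is a quotient of elements of the algebra `𝒜`. -/
def ExpEquiv (𝒜 : Subalgebra ℂ (ℂ → ℂ)) (u v : ℂ → ℂ) : Prop :=
  ∃ a ∈ 𝒜, ∃ b ∈ 𝒜, a ≠ 0 ∧ b ≠ 0 ∧ ∀ z, Complex.exp (u z) * b z = Complex.exp (v z) * a z

theorem ExpEquiv.refl (𝒜 : Subalgebra ℂ (ℂ → ℂ)) (u : ℂ → ℂ) : ExpEquiv 𝒜 u u :=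
  ⟨1, 𝒜.one_mem, 1, 𝒜.one_mem, one_ne_zero, one_ne_zero, fun _ => rfl⟩

/-- Collects a partial sum over one equivalence class into a single exponential with a coefficient
in the fraction field of `𝒜`. -/
theorem exists_common_denominator {𝒜 : Subalgebra ℂ (ℂ → ℂ)}
    (h𝒜 : ∀ a ∈ 𝒜, Differentiable ℂ a) {ι : Type*} (p : ι → ℂ → ℂ) (v : ℂ → ℂ)
    (T : Finset ι) (hT : ∀ i ∈ T, ExpEquiv 𝒜 (p i) v) (a : ι → ℂ → ℂ) (ha : ∀ i ∈ T, a i ∈ 𝒜) :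
    ∃ α ∈ 𝒜, ∃ β ∈ 𝒜, β ≠ 0 ∧
      ∀ z, β z * ∑ i ∈ T, a i z * Complex.exp (p i z) = Complex.exp (v z) * α z := by
  classical
  induction T using Finset.induction_on with
  | empty => exact ⟨0, 𝒜.zero_mem, 1, 𝒜.one_mem, one_ne_zero, fun z => by simp⟩
  | insert i T hi ih =>
    obtain ⟨α, hα, β, hβ, hβ0, h⟩ := ih (fun j hj => hT j (Finset.mem_insert_of_mem hj))
      (fun j hj => ha j (Finset.mem_insert_of_mem hj))
    obtain ⟨c, hc, d, hd, -, hd0, h'⟩ := hT i (Finset.mem_insert_self _ _)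
    refine ⟨α * d + β * a i * c, ?_, β * d, 𝒜.mul_mem hβ hd,
      entire_mul_ne_zero (h𝒜 _ hβ) (h𝒜 _ hd) hβ0 hd0, fun z => ?_⟩
    · exact 𝒜.add_mem (𝒜.mul_mem hα hd)
        (𝒜.mul_mem (𝒜.mul_mem hβ (ha i (Finset.mem_insert_self _ _))) hc)
    · rw [Finset.sum_insert hi]
      simp only [Pi.mul_apply, Pi.add_apply]
      linear_combination d z * h z + β z * a i z * h' z

-- A vanishing sum splits along equivalence classes. Dividing by `a l * exp (p l)` and
-- differentiating kills the term `l` and keeps the coefficients in `𝒜`, so induction makes the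
-- Wronskian of `a l` and the `T`-part vanish. The `T`-part is then a constant multiple of `a l *
-- exp (p l)`, and a nonzero constant would put `l` into the class of `k`.
open Classical in
theorem sum_expEquiv_eq_zero {𝒜 : Subalgebra ℂ (ℂ → ℂ)}
    (h𝒜 : ∀ a ∈ 𝒜, Differentiable ℂ a) (h𝒜' : ∀ a ∈ 𝒜, deriv a ∈ 𝒜) {ι : Type*}
    (p : ι → ℂ → ℂ) (hp : ∀ i, Differentiable ℂ (p i)) (k : ι) (T : Finset ι)
    (hT : ∀ i ∈ T, ExpEquiv 𝒜 (p i) (p k)) (U : Finset ι)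
    (hU : ∀ i ∈ U, ¬ ExpEquiv 𝒜 (p i) (p k))
    (hdiff : ∀ i ∈ T ∪ U, ∀ j ∈ U, p i - p j ∈ 𝒜) (a : ι → ℂ → ℂ)
    (ha : ∀ i ∈ T ∪ U, a i ∈ 𝒜)
    (h : ∀ z, ∑ i ∈ T, a i z * Complex.exp (p i z) + ∑ i ∈ U, a i z * Complex.exp (p i z) = 0) :
    ∀ z, ∑ i ∈ T, a i z * Complex.exp (p i z) = 0 := by
  induction U using Finset.induction_on generalizing a with
  | empty => simpa using h
  | insert l U hl ih =>
    have hlm : l ∈ T ∪ insert l U := by simp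
    have hsub : ∀ i ∈ T ∪ U, i ∈ T ∪ insert l U := by
      intro i hi; simp only [Finset.mem_union, Finset.mem_insert] at hi ⊢; tauto
    have hU' : ∀ i ∈ U, ¬ ExpEquiv 𝒜 (p i) (p k) := fun i hi => hU i (Finset.mem_insert_of_mem hi)
    have hdiff' : ∀ i ∈ T ∪ U, ∀ j ∈ U, p i - p j ∈ 𝒜 := fun i hi j hj =>
      hdiff i (hsub i hi) j (Finset.mem_insert_of_mem hj)
    by_cases hl0 : a l = 0
    · refine ih hU' hdiff' a (fun i hi => ha i (hsub i hi)) (fun z => ?_)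
      have := h z
      rw [Finset.sum_insert hl, hl0] at this
      simpa using this
    have hal := ha l hlm
    have hald := h𝒜 _ hal
    let q : ι → ℂ → ℂ := fun i => p i - p l
    have hq : ∀ i ∈ T ∪ U, q i ∈ 𝒜 := fun i hi =>
      hdiff i (hsub i hi) l (Finset.mem_insert_self _ _)
    -- The derivative of `(a i / a l) * exp (q i)` is `D i * exp (q i) / a l ^ 2`.
    let D : ι → ℂ → ℂ := fun i => a l * (deriv (a i) + a i * deriv (q i)) - deriv (a l) * a i
    have hD : ∀ i ∈ T ∪ U, D i ∈ 𝒜 := fun i hi =>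
      𝒜.sub_mem (𝒜.mul_mem hal (𝒜.add_mem (h𝒜' _ (ha i (hsub i hi)))
        (𝒜.mul_mem (ha i (hsub i hi)) (h𝒜' _ (hq i hi)))))
        (𝒜.mul_mem (h𝒜' _ hal) (ha i (hsub i hi)))
    let g : Finset ι → ℂ → ℂ := fun V z => ∑ i ∈ V, a i z * Complex.exp (q i z)
    have hg : ∀ V ⊆ T ∪ U, ∀ z, HasDerivAt (g V)
        (∑ i ∈ V, (deriv (a i) z + a i z * deriv (q i) z) * Complex.exp (q i z)) z := by
      intro V hV z
      apply HasDerivAt.fun_sum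
      intro i hi
      have h1 := ((h𝒜 _ (ha i (hsub i (hV hi)))) z).hasDerivAt
      have h2 := ((((hp i).sub (hp l)) z).hasDerivAt).cexp
      refine (h1.fun_mul h2).congr_deriv ?_
      change deriv (a i) z * Complex.exp (q i z) +
        a i z * (Complex.exp (q i z) * deriv (q i) z) = _
      ring
    have hDg : ∀ V ⊆ T ∪ U, ∀ z, ∑ i ∈ V, D i z * Complex.exp (q i z) =
        a l z * deriv (g V) z - deriv (a l) z * g V z := by
      intro V hV z
      rw [(hg V hV z).deriv, Finset.mul_sum, Finset.mul_sum, ← Finset.sum_sub_distrib]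
      refine Finset.sum_congr rfl fun i _ => ?_
      simp only [D, Pi.sub_apply, Pi.mul_apply, Pi.add_apply]; ring
    have hexp : ∀ (c : ι → ℂ → ℂ) (V : Finset ι) z, ∑ i ∈ V, c i z * Complex.exp (p i z) =
        Complex.exp (p l z) * ∑ i ∈ V, c i z * Complex.exp (q i z) := by
      intro c V z
      rw [Finset.mul_sum]
      refine Finset.sum_congr rfl fun i _ => ?_
      have : p i z = p l z + q i z := by simp [q]
      rw [this, Complex.exp_add]; ring
    have hsum : ∀ z, g T z + g U z = - a l z := by
      intro z
      have := h z
      rw [Finset.sum_insert hl, hexp, hexp a U] at this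
      have e := Complex.exp_ne_zero (p l z)
      have : Complex.exp (p l z) * (g T z + g U z + a l z) = 0 := by rw [← this]; ring
      have := (mul_eq_zero.mp this).resolve_left e
      linear_combination this
    have hT' := Finset.subset_union_left (s₁ := T) (s₂ := U)
    have hUU := Finset.subset_union_right (s₁ := T) (s₂ := U)
    have key := ih hU' hdiff' D hD (fun z => by
      rw [hexp, hexp D U, hDg T hT', hDg U hUU]
      have e1 : deriv (g T) z + deriv (g U) z = - deriv (a l) z := by
        rw [← deriv_add (hg T hT' z).differentiableAt (hg U hUU z).differentiableAt, ← deriv.neg]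
        congr 1
        funext z; exact hsum z
      have e2 := hsum z
      linear_combination Complex.exp (p l z) * (a l z * e1 - deriv (a l) z * e2))
    have hgT : Differentiable ℂ (g T) := fun z => (hg T hT' z).differentiableAt
    obtain ⟨c, hc⟩ := exists_eq_smul_of_wronskian hald hgT hl0 (by
      funext z
      have := key z
      rw [hexp, hDg T hT'] at this
      have := (mul_eq_zero.mp this).resolve_left (Complex.exp_ne_zero _)
      simp only [Pi.mul_apply]
      linear_combination this)
    intro z
    rw [hexp]
    change Complex.exp (p l z) * g T z = 0
    by_cases hc0 : c = 0
    · rw [hc, hc0]; simp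
    exfalso
    -- With `c ≠ 0`, the common denominator exhibits `exp (p l) / exp (p k)` as a quotient of
    -- elements of `𝒜`.
    obtain ⟨α, hα, β, hβ, hβ0, hαβ⟩ := exists_common_denominator h𝒜 p (p k) T hT a
      (fun i hi => ha i (hsub i (hT' hi)))
    have hrel : ∀ z, Complex.exp (p l z) * ((c • (β * a l)) z) = Complex.exp (p k z) * α z := by
      intro z
      rw [← hαβ z, hexp]
      have := congrFun hc z
      simp only [g] at this
      rw [this]
      simp only [Pi.smul_apply, Pi.mul_apply, smul_eq_mul]; ring
    have hne : c • (β * a l) ≠ 0 :=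
      smul_ne_zero hc0 (entire_mul_ne_zero (h𝒜 _ hβ) hald hβ0 hl0)
    refine hU l (Finset.mem_insert_self _ _) ⟨α, hα, _, 𝒜.smul_mem (𝒜.mul_mem hβ hal) c, ?_, hne,
      hrel⟩
    rintro rfl
    apply hne
    funext z
    simpa [Complex.exp_ne_zero] using hrel z

/-! ### Estimates for the real parts of exponents -/

/-- The maximum of `∑ |Re uᵢ|` on the closed disc of radius `r`. -/
noncomputable def reMax {ι : Type*} [Fintype ι] (u : ι → ℂ → ℂ) (r : ℝ) : ℝ :=
  sSup ((fun z => ∑ i, |(u i z).re|) '' closedBall (0 : ℂ) r)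

section reMax

variable {ι : Type*} [Fintype ι] {u : ι → ℂ → ℂ}

theorem reMax_nonneg (u : ι → ℂ → ℂ) (r : ℝ) : 0 ≤ reMax u r := by
  apply Real.sSup_nonneg
  rintro _ ⟨z, -, rfl⟩
  exact Finset.sum_nonneg fun i _ => abs_nonneg _

theorem continuous_sum_abs_re (hu : ∀ i, Differentiable ℂ (u i)) :
    Continuous fun z => ∑ i, |(u i z).re| :=
  continuous_finsetSum _ fun i _ => (Complex.continuous_re.comp (hu i).continuous).abs

theorem isCompact_image_sum_abs_re (hu : ∀ i, Differentiable ℂ (u i)) (r : ℝ) :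
    IsCompact ((fun z => ∑ i, |(u i z).re|) '' closedBall (0 : ℂ) r) :=
  (isCompact_closedBall _ _).image (continuous_sum_abs_re hu)

theorem sum_abs_re_le_reMax (hu : ∀ i, Differentiable ℂ (u i)) {r : ℝ} {z : ℂ} (hz : ‖z‖ ≤ r) :
    ∑ i, |(u i z).re| ≤ reMax u r :=
  le_csSup (isCompact_image_sum_abs_re hu r).bddAbove ⟨z, by simpa using hz, rfl⟩

theorem abs_re_le_reMax (hu : ∀ i, Differentiable ℂ (u i)) {r : ℝ} {z : ℂ} (hz : ‖z‖ ≤ r) (i : ι) :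
    |(u i z).re| ≤ reMax u r :=
  (Finset.single_le_sum (f := fun i => |(u i z).re|) (fun _ _ => abs_nonneg _)
    (Finset.mem_univ i)).trans (sum_abs_re_le_reMax hu hz)

theorem exists_eq_reMax (hu : ∀ i, Differentiable ℂ (u i)) {r : ℝ} (hr : 0 ≤ r) :
    ∃ z : ℂ, ‖z‖ ≤ r ∧ reMax u r = ∑ i, |(u i z).re| := by
  obtain ⟨z, hz, h⟩ := (isCompact_image_sum_abs_re hu r).sSup_mem
    ((nonempty_closedBall.mpr hr).image _)
  exact ⟨z, by simpa using hz, h.symm⟩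

theorem reMax_mono (hu : ∀ i, Differentiable ℂ (u i)) {r R : ℝ} (hr : 0 ≤ r) (h : r ≤ R) :
    reMax u r ≤ reMax u R := by
  obtain ⟨z, hz, hz'⟩ := exists_eq_reMax hu hr
  rw [hz']
  exact sum_abs_re_le_reMax hu (hz.trans h)

/-- The Borel–Carathéodory inequality: the real part controls the modulus, at the cost of a factor
`R / (R - r)`. -/
theorem mem_moderateGrowth_reMax (hu : ∀ i, Differentiable ℂ (u i)) (i : ι) :
    u i ∈ moderateGrowth (reMax u) (reMax_nonneg u) := by
  refine ⟨hu i, 2 + 2 * ‖u i 0‖, 1, by positivity, fun r R hr hR z hz => ?_⟩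
  have hM := reMax_nonneg u R
  have hR0 : 0 < R := by linarith
  have hbc := Complex.borelCaratheodory (M := 1 + reMax u R) (R := R) (z := z) (by linarith)
    (hu i).differentiableOn (fun w hw => by
      have := abs_re_le_reMax hu (r := R) (z := w) (by simpa using (mem_ball_zero_iff.mp hw).le) i
      simp only [mem_ofPred_eq]
      linarith [le_abs_self (u i w).re]) hR0 (by simpa using lt_of_le_of_lt hz hR)
  have hzR : 0 < R - r := by linarith
  have h0 : 0 ≤ ‖z‖ := norm_nonneg z
  calc _ ≤ _ := hbc
    _ ≤ 2 * (1 + reMax u R) * R / (R - r) + ‖u i 0‖ * (R + R) / (R - r) := by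
      gcongr <;> linarith
    _ = (2 * (1 + reMax u R) + 2 * ‖u i 0‖ * 1) * (R / (R - r)) := by ring
    _ ≤ (2 * (1 + reMax u R) + 2 * ‖u i 0‖ * (1 + reMax u R)) * (R / (R - r)) := by
      gcongr; linarith
    _ = _ := by unfold growthScale; ring

end reMax

/-- Jensen's formula: for `R ≥ 1` the zeros contribute nonnegatively, leaving the logarithm of the
trailing coefficient at `0`. -/
theorem exists_le_circleAverage_log_norm {b : ℂ → ℂ} (hb : Differentiable ℂ b) :
    ∃ K : ℝ, ∀ R, 1 ≤ R → K ≤ circleAverage (fun z => log ‖b z‖) 0 R := by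
  refine ⟨log ‖meromorphicTrailingCoeffAt b 0‖, fun R hR => ?_⟩
  have han : AnalyticOnNhd ℂ b (closedBall 0 |R|) := fun z _ => hb.analyticAt z
  have hdiv := MeromorphicOn.AnalyticOnNhd.divisor_nonneg han
  rw [han.meromorphicOn.circleAverage_log_norm (by linarith)]
  have h1 : 0 ≤ ∑ᶠ v, (MeromorphicOn.divisor b (closedBall 0 |R|) v : ℝ) *
      log (R * ‖(0 : ℂ) - v‖⁻¹) := by
    apply finsum_nonneg
    intro v
    by_cases hv : v ∈ closedBall (0 : ℂ) |R|
    · apply mul_nonneg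
      · exact_mod_cast hdiv v
      · rw [zero_sub, norm_neg]
        -- The summand at the centre is zero since `0⁻¹ = 0` and `log 0 = 0`; a zero at the origin
        -- is counted by the separate `log R` term.
        by_cases hv0 : v = 0
        · simp [hv0]
        apply log_nonneg
        have h2 : ‖v‖ ≤ R := by simpa [abs_of_pos (by linarith : (0:ℝ) < R)] using hv
        have h3 : 0 < ‖v‖ := norm_pos_iff.mpr hv0
        rw [← div_eq_mul_inv, le_div_iff₀ h3]; linarith
    · simp [Function.locallyFinsuppWithin.apply_eq_zero_of_notMem _ hv]
  have h2 : 0 ≤ (MeromorphicOn.divisor b (closedBall 0 |R|) 0 : ℝ) * log R :=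
    mul_nonneg (by exact_mod_cast hdiv 0) (log_nonneg hR)
  linarith

/-- Off the zeros, `Re u = log ‖a‖ - log ‖b‖`, and both logarithms are at most `log B`, so `|Re u| ≤
2 log B - log ‖a‖ - log ‖b‖`. Jensen's formula bounds the averages of the two logarithms from below.
-/
theorem circleAverage_abs_re_le {u a b : ℂ → ℂ} (hu : Differentiable ℂ u)
    (ha : Differentiable ℂ a) (hb : Differentiable ℂ b) (hb0 : b ≠ 0)
    (h : ∀ z, Complex.exp (u z) * b z = a z) :
    ∃ K : ℝ, ∀ R B, 1 ≤ R → 1 ≤ B → (∀ z, ‖z‖ = R → ‖a z‖ ≤ B ∧ ‖b z‖ ≤ B) →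
      circleAverage (fun z => |(u z).re|) 0 R ≤ 2 * log B + K := by
  obtain ⟨Ka, hKa⟩ := exists_le_circleAverage_log_norm ha
  obtain ⟨Kb, hKb⟩ := exists_le_circleAverage_log_norm hb
  refine ⟨-Ka - Kb, fun R B hR hB hz => ?_⟩
  have hR0 : R ≠ 0 := by linarith
  obtain ⟨x, hx⟩ := Function.ne_iff.mp hb0
  have hcod := AnalyticOnNhd.preimage_zero_mem_codiscrete (f := b) (x := x)
    (fun z _ => hb.analyticAt z) hx
  have hia : CircleIntegrable (fun z => log ‖a z‖) 0 R :=
    (AnalyticOnNhd.meromorphicOn fun z _ => ha.analyticAt z).circleIntegrable_log_norm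
  have hib : CircleIntegrable (fun z => log ‖b z‖) 0 R :=
    (AnalyticOnNhd.meromorphicOn fun z _ => hb.analyticAt z).circleIntegrable_log_norm
  have hiu : CircleIntegrable (fun z => |(u z).re|) 0 R :=
    (Continuous.continuousOn
      (Complex.continuous_re.comp hu.continuous).abs).circleIntegrable (by linarith)
  -- At zeros of `b` the convention `log 0 = 0` would spoil the pointwise bound, so the integrand is
  -- changed there; the exceptional set does not affect the average.
  let φ : ℂ → ℝ := fun z => if b z = 0 then 0 else |(u z).re|
  have hφ : (fun z => |(u z).re|) =ᶠ[codiscreteWithin (sphere (0 : ℂ) |R|)] φ := by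
    have : b ⁻¹' {0}ᶜ ∈ codiscreteWithin (sphere (0 : ℂ) |R|) :=
      codiscreteWithin_mono (subset_univ _) hcod
    filter_upwards [this] with z hz
    have hz : b z ≠ 0 := hz
    simp [φ, hz]
  have hiφ : CircleIntegrable φ 0 R := hiu.congr_codiscreteWithin hφ
  rw [circleAverage_congr_codiscreteWithin hφ hR0]
  have hic : CircleIntegrable (fun _ : ℂ => 2 * log B) 0 R :=
    continuousOn_const.circleIntegrable (by linarith)
  have hiab : CircleIntegrable (fun z => log ‖a z‖ + log ‖b z‖) 0 R := hia.add hib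
  have hisub : CircleIntegrable (fun z => 2 * log B - (log ‖a z‖ + log ‖b z‖)) 0 R := hic.sub hiab
  calc _ ≤ circleAverage (fun z => 2 * log B - (log ‖a z‖ + log ‖b z‖)) 0 R := by
        apply circleAverage_mono hiφ hisub
        intro z hzs
        have hzR : ‖z‖ = R := by simpa [abs_of_pos (by linarith : (0:ℝ) < R)] using hzs
        obtain ⟨h1, h2⟩ := hz z hzR
        have hlB := log_nonneg hB
        by_cases hbz : b z = 0
        · have haz : a z = 0 := by rw [← h, hbz, mul_zero]
          simp [φ, hbz, haz, hlB]
        · have haz : a z ≠ 0 := by rw [← h]; exact mul_ne_zero (Complex.exp_ne_zero _) hbz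
          have e : log ‖a z‖ = (u z).re + log ‖b z‖ := by
            rw [← h, norm_mul, Complex.norm_exp, log_mul (exp_pos _).ne' (norm_ne_zero_iff.mpr hbz),
              log_exp]
          have l1 := log_le_log (norm_pos_iff.mpr haz) h1
          have l2 := log_le_log (norm_pos_iff.mpr hbz) h2
          simp only [φ, hbz, if_false]
          rw [abs_le]; constructor <;> linarith
    _ = 2 * log B - (circleAverage (fun z => log ‖a z‖) 0 R +
          circleAverage (fun z => log ‖b z‖) 0 R) := by
        rw [circleAverage_fun_sub hic hiab, circleAverage_fun_add hia hib,
          circleAverage_const]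
    _ ≤ _ := by linarith [hKa R hR, hKb R hR]

/-- Poisson's formula with the Harnack bound `(R + r) / (R - r)` on the kernel. -/
theorem abs_re_le_circleAverage {u : ℂ → ℂ} (hu : Differentiable ℂ u) {r R : ℝ} (hr : 0 ≤ r)
    (hR : r < R) {w : ℂ} (hw : ‖w‖ ≤ r) :
    |(u w).re| ≤ (R + r) / (R - r) * circleAverage (fun z => |(u z).re|) 0 R := by
  have hRpos : 0 < R := by linarith
  have hwb : w ∈ ball (0 : ℂ) R := by simpa using lt_of_le_of_lt hw hR
  have hP := (hu.diffContOnCl (s := ball 0 R)).circleAverage_re_herglotzRieszKernel_smul' hwb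
  let k : ℂ → ℝ := fun z => ((z - 0 + (w - 0)) / ((z - 0) - (w - 0))).re
  have hk : ContinuousOn k (sphere 0 |R|) :=
    Complex.continuous_re.comp_continuousOn (continuousOn_herglotzRieszKernel_sphere hwb)
  have hki : CircleIntegrable (fun z => k z • u z) 0 R :=
    (hk.smul hu.continuous.continuousOn).circleIntegrable' 
  have hre : (u w).re = circleAverage (fun z => k z * (u z).re) 0 R := by
    rw [← hP]
    have := Complex.reCLM.circleAverage_comp_comm hki
    change Complex.reCLM (circleAverage (fun z => k z • u z) 0 R) = _
    rw [← this]
    congr 1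
    funext z
    simp
  have hi1 : CircleIntegrable (fun z => |(u z).re|) 0 R :=
    (Continuous.continuousOn
      (Complex.continuous_re.comp hu.continuous).abs).circleIntegrable hRpos.le
  have hi2 : CircleIntegrable (|fun z => k z * (u z).re|) 0 R :=
    ((hk.mul (Complex.continuous_re.comp hu.continuous).continuousOn).abs).circleIntegrable'
  rw [hre]
  refine abs_circleAverage_le_circleAverage_abs.trans ?_
  rw [← smul_eq_mul, ← circleAverage_fun_smul]
  apply circleAverage_mono hi2 (hi1.const_fun_smul)
  intro z hz
  have hz' : z ∈ sphere (0 : ℂ) R := by rwa [abs_of_pos hRpos] at hz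
  have h1 := re_herglotzRieszKernel_le hz' hwb
  have h2 := le_re_herglotzRieszKernel hz' hwb
  have h0 : 0 ≤ k z := le_trans (div_nonneg (by simp; linarith) (by positivity)) h2
  have h3 : k z ≤ (R + r) / (R - r) := h1.trans (by
    rw [sub_zero]; gcongr)
  simp only [Pi.abs_apply, abs_mul, abs_of_nonneg h0, smul_eq_mul]
  gcongr

section

variable {ι : Type*} [Fintype ι] {u : ι → ℂ → ℂ}

theorem circleAverage_abs_re_le_log_growthScale {M : ℝ → ℝ} {hM : ∀ r, 0 ≤ M r} {v a b : ℂ → ℂ}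
    (hv : Differentiable ℂ v) (ha : a ∈ moderateGrowth M hM) (hb : b ∈ moderateGrowth M hM)
    (hb0 : b ≠ 0) (h : ∀ z, Complex.exp (v z) * b z = a z) :
    ∃ c d : ℝ, 0 ≤ c ∧ 0 ≤ d ∧ ∀ r R, 1 ≤ r → r < R →
      circleAverage (fun z => |(v z).re|) 0 r ≤ c + d * log (growthScale M r R) := by
  obtain ⟨ha, Ca, Da, hCa, ha'⟩ := ha
  obtain ⟨hb, Cb, Db, hCb, hb'⟩ := hb
  obtain ⟨K, hK⟩ := circleAverage_abs_re_le hv ha hb hb0 h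
  refine ⟨2 * log (1 + Ca + Cb) + |K|, 2 * (Da + Db : ℕ), ?_, by positivity, fun r R hr hR => ?_⟩
  · have : 0 ≤ log (1 + Ca + Cb) := log_nonneg (by linarith)
    positivity
  have h1 := one_le_growthScale hM hr hR
  have hpow : ∀ D : ℕ, 1 ≤ growthScale M r R ^ D := fun D => one_le_pow₀ h1
  have hB : 1 ≤ (1 + Ca + Cb) * growthScale M r R ^ (Da + Db) := by
    nlinarith [hpow (Da + Db)]
  have := hK r _ hr hB (fun z hz => ⟨(ha' r R hr hR z hz.le).trans ?_,
    (hb' r R hr hR z hz.le).trans ?_⟩)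
  · rw [log_mul (by positivity) (by positivity), log_pow] at this
    linarith [le_abs_self K]
  · gcongr <;> linarith
  · gcongr <;> linarith

/-- Bounds `reMax` by the logarithm of its own growth scale: Poisson passes from the maximum to
circle averages, Jensen from these to logarithms of bounds in the algebra. -/
theorem reMax_le_log_growthScale (hu : ∀ i, Differentiable ℂ (u i))
    (h : ∀ i, ∃ a ∈ moderateGrowth (reMax u) (reMax_nonneg u),
      ∃ b ∈ moderateGrowth (reMax u) (reMax_nonneg u), b ≠ 0 ∧
        ∀ z, Complex.exp (u i z) * b z = a z) :
    ∃ c d : ℝ, 0 ≤ c ∧ 0 ≤ d ∧ ∀ r R R', 1 ≤ r → r < R → R < R' →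
      reMax u r ≤ (R + r) / (R - r) * (c + d * log (growthScale (reMax u) R R')) := by
  have h' : ∀ i, ∃ c d : ℝ, 0 ≤ c ∧ 0 ≤ d ∧ ∀ r R, 1 ≤ r → r < R →
      circleAverage (fun z => |(u i z).re|) 0 r ≤ c + d * log (growthScale (reMax u) r R) := by
    intro i
    obtain ⟨a, ha, b, hb, hb0, hab⟩ := h i
    exact circleAverage_abs_re_le_log_growthScale (hu i) ha hb hb0 hab
  choose c d hc hd hcd using h'
  refine ⟨∑ i, c i, ∑ i, d i, Finset.sum_nonneg fun i _ => hc i, Finset.sum_nonneg fun i _ => hd i,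
    fun r R R' hr hR hR' => ?_⟩
  obtain ⟨w, hw, hw'⟩ := exists_eq_reMax hu (r := r) (by linarith)
  rw [hw', Finset.sum_mul, ← Finset.sum_add_distrib, Finset.mul_sum]
  refine Finset.sum_le_sum fun i _ => (abs_re_le_circleAverage (hu i) (by linarith) hR hw).trans ?_
  have : 0 ≤ (R + r) / (R - r) := div_nonneg (by linarith) (by linarith)
  gcongr
  exact hcd i R R' (by linarith) hR'

theorem div_exp_sub_le {x t : ℝ} (ht : 0 < t) (ht1 : t ≤ 1) :
    rexp (x + t) / (rexp (x + t) - rexp x) ≤ 2 / t := by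
  have hx := exp_pos x
  have h1 : 1 + t ≤ rexp t := by linarith [add_one_le_exp t]
  have hpos : 0 < rexp (x + t) - rexp x := by rw [exp_add]; nlinarith
  rw [div_le_div_iff₀ hpos ht, exp_add]
  have h2 : rexp t * (2 - t) ≥ 2 := by nlinarith
  nlinarith

/-- With `L = log (e + reMax)` in the variable `log r`, the logarithmic bound at a point of slow
growth reads `reMax ≤ const * L ^ 3`, incompatible with `exp L = e + reMax` once `L` is large. -/
theorem exists_reMax_le (hu : ∀ i, Differentiable ℂ (u i))
    (h : ∀ i, ∃ a ∈ moderateGrowth (reMax u) (reMax_nonneg u),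
      ∃ b ∈ moderateGrowth (reMax u) (reMax_nonneg u), b ≠ 0 ∧
        ∀ z, Complex.exp (u i z) * b z = a z) :
    ∃ B, ∀ r, reMax u r ≤ B := by
  obtain ⟨c, d, hc, hd, hcd⟩ := reMax_le_log_growthScale hu h
  by_contra! hB
  let L : ℝ → ℝ := fun x => log (rexp 1 + reMax u (rexp x))
  have hexpL : ∀ x, rexp (L x) = rexp 1 + reMax u (rexp x) := fun x =>
    exp_log (by linarith [exp_pos 1, reMax_nonneg u (rexp x)])
  have hLm : Monotone L := fun x y hxy => by
    apply log_le_log (by linarith [exp_pos 1, reMax_nonneg u (rexp x)])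
    linarith [reMax_mono hu (exp_pos x).le (exp_le_exp.mpr hxy)]
  have hL1 : ∀ x, 1 ≤ L x := fun x => by
    rw [← exp_le_exp, hexpL]; linarith [reMax_nonneg u (rexp x)]
  obtain ⟨L₀, hL₀⟩ := eventually_atTop.mp
    ((tendsto_exp_div_pow_atTop 3).eventually_gt_atTop (rexp 1 + 8 * (c + d * 6)))
  obtain ⟨r₀, hr₀⟩ := hB (rexp L₀)
  have hr₀0 : 0 ≤ r₀ := by
    by_contra! hneg
    have : reMax u r₀ = 0 := by simp [reMax, closedBall_eq_empty.mpr hneg]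
    linarith [exp_pos L₀]
  obtain ⟨x, hx, hgrow⟩ := exists_slow_growth hLm hL1 r₀
  have hLx := hL1 x
  have hL₀x : L₀ ≤ L x := by
    refine le_trans ?_ (hLm hx)
    rw [← exp_le_exp, hexpL]
    have := reMax_mono hu hr₀0 (by linarith [add_one_le_exp r₀] : r₀ ≤ rexp r₀)
    linarith [exp_pos 1]
  have hfin := hL₀ _ hL₀x
  rw [lt_div_iff₀ (by positivity), hexpL] at hfin
  set l := L x with hl
  -- The radii are `exp x`, `exp (x + t)`, `exp (x + 2t)` with `2t = 1 / l ^ 2`, the slow-growth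
  -- step: one gap serves the Poisson kernel, the other the growth scale.
  have ht : 0 < 1 / (2 * l ^ 2) := by positivity
  have ht1 : 1 / (2 * l ^ 2) ≤ 1 := by
    rw [div_le_one (by positivity)]; nlinarith
  set t := 1 / (2 * l ^ 2) with htdef
  have h2t : 1 / l ^ 2 = t + t := by rw [htdef]; field_simp; norm_num
  rw [h2t] at hgrow
  have e4 : 2 / t = 4 * l ^ 2 := by rw [htdef]; field_simp; norm_num
  have q1 := div_exp_sub_le (x := x) ht ht1
  have q2 := div_exp_sub_le (x := x + t) ht ht1
  rw [e4] at q1 q2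
  have m1 : rexp x < rexp (x + t) := exp_lt_exp.mpr (by linarith)
  have m2 : rexp (x + t) < rexp (x + t + t) := exp_lt_exp.mpr (by linarith)
  have hx1 : 1 ≤ rexp x := by rw [← exp_zero]; exact exp_le_exp.mpr (by linarith)
  have key := hcd _ _ _ hx1 m1 m2
  have hΦ1 := one_le_growthScale (reMax_nonneg u) (by linarith : 1 ≤ rexp (x + t)) m2
  have hΦ : log (growthScale (reMax u) (rexp (x + t)) (rexp (x + t + t))) ≤ 6 * l := by
    have hM : 1 + reMax u (rexp (x + t + t)) ≤ rexp (2 * l) := by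
      calc _ ≤ rexp (L (x + t + t)) := by
            rw [hexpL]; linarith [add_one_le_exp (1 : ℝ)]
        _ ≤ _ := by rw [add_assoc]; exact exp_le_exp.mpr hgrow
    have hl2 : 4 * l ^ 2 ≤ rexp (4 * l) := by
      have h2 : 2 * l ≤ rexp (2 * l) := by linarith [add_one_le_exp (2 * l)]
      calc 4 * l ^ 2 = (2 * l) * (2 * l) := by ring
        _ ≤ rexp (2 * l) * rexp (2 * l) := by gcongr
        _ = _ := by rw [← exp_add]; ring_nf
    rw [log_le_iff_le_exp (by linarith)]
    calc _ ≤ rexp (2 * l) * rexp (4 * l) := by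
          unfold growthScale
          have := reMax_nonneg u (rexp (x + t + t))
          gcongr
          exact q2.trans hl2
      _ = _ := by rw [← exp_add]; ring_nf
  have hP : (rexp (x + t) + rexp x) / (rexp (x + t) - rexp x) ≤ 8 * l ^ 2 := by
    calc _ ≤ (rexp (x + t) + rexp (x + t)) / (rexp (x + t) - rexp x) := by
          gcongr
      _ = 2 * (rexp (x + t) / (rexp (x + t) - rexp x)) := by ring
      _ ≤ _ := by linarith
  have hfinal : reMax u (rexp x) ≤ 8 * (c + d * 6) * l ^ 3 := by
    calc _ ≤ _ := key
      _ ≤ 8 * l ^ 2 * (c + d * (6 * l)) := by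
        have : 0 ≤ log (growthScale (reMax u) (rexp (x + t)) (rexp (x + t + t))) :=
          log_nonneg hΦ1
        gcongr
      _ ≤ 8 * l ^ 2 * (c * l + d * (6 * l)) := by gcongr; nlinarith
      _ = _ := by ring
  have h3 : 1 ≤ l ^ 3 := one_le_pow₀ hLx
  nlinarith [exp_pos 1]

/-- Liouville's theorem for `exp (u i)`. -/
theorem eq_of_reMax_le (hu : ∀ i, Differentiable ℂ (u i)) {B : ℝ} (hB : ∀ r, reMax u r ≤ B)
    (i : ι) (z w : ℂ) : u i z = u i w := by
  have hbd : Bornology.IsBounded (range fun z => Complex.exp (u i z)) := by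
    rw [isBounded_iff_forall_norm_le]
    refine ⟨rexp B, ?_⟩
    rintro _ ⟨z, rfl⟩
    rw [Complex.norm_exp, exp_le_exp]
    exact (le_abs_self _).trans ((abs_re_le_reMax hu le_rfl i).trans (hB ‖z‖))
  have hconst := (hu i).cexp.apply_eq_apply_of_bounded hbd
  refine is_const_of_deriv_eq_zero (hu i) (fun x => ?_) z w
  have h1 := ((hu i) x).hasDerivAt.cexp
  have h2 : HasDerivAt (fun z => Complex.exp (u i z)) 0 x := by
    have : (fun z => Complex.exp (u i z)) = fun _ => Complex.exp (u i x) := by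
      funext z; exact hconst z x
    rw [this]; exact hasDerivAt_const _ _
  have := h1.unique h2
  simpa [Complex.exp_ne_zero] using this

end

/-! ### Borel's lemma -/

/-- **Borel's lemma**: in a vanishing sum of nonzero multiples of exponentials of entire functions,
the exponents agree in pairs up to constants. -/
theorem borel_lemma {ι : Type*} (p : ι → ℂ → ℂ) (hp : ∀ i, Differentiable ℂ (p i))
    (S : Finset ι) (c : ι → ℂ) (hc : ∀ i ∈ S, c i ≠ 0)
    (h : ∀ z, ∑ i ∈ S, c i * Complex.exp (p i z) = 0) (k : ι) (hk : k ∈ S) :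
    ∃ i ∈ S, i ≠ k ∧ ∀ z w, p i z - p k z = p i w - p k w := by
  classical
  induction hn : S.card using Nat.strong_induction_on generalizing S with
  | _ n ih =>
  subst hn
  -- Growth is measured by all differences of exponents at once, so these differences lie in `𝒜`
  -- themselves.
  let u : S × S → ℂ → ℂ := fun s => p s.1 - p s.2
  have hu : ∀ s, Differentiable ℂ (u s) := fun s => (hp _).sub (hp _)
  let 𝒜 := moderateGrowth (reMax u) (reMax_nonneg u)
  have hu𝒜 : ∀ s, u s ∈ 𝒜 := fun s => mem_moderateGrowth_reMax hu s
  let T := S.filter fun i => ExpEquiv 𝒜 (p i) (p k)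
  let U := S.filter fun i => ¬ ExpEquiv 𝒜 (p i) (p k)
  have hkT : k ∈ T := Finset.mem_filter.mpr ⟨hk, ExpEquiv.refl _ _⟩
  have hTS : T ⊆ S := Finset.filter_subset _ _
  have hT : ∀ z, ∑ i ∈ T, c i * Complex.exp (p i z) = 0 := by
    refine sum_expEquiv_eq_zero (𝒜 := 𝒜) (fun a ha => moderateGrowth_differentiable ha)
      (fun a ha => moderateGrowth_deriv ha) p hp k T (fun i hi => (Finset.mem_filter.mp hi).2) U
      (fun i hi => (Finset.mem_filter.mp hi).2) ?_ (fun i _ => c i) ?_ ?_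
    · intro i hi j hj
      have hi' : i ∈ S := by
        rcases Finset.mem_union.mp hi with hi | hi <;> exact (Finset.mem_filter.mp hi).1
      exact hu𝒜 (⟨i, hi'⟩, ⟨j, (Finset.mem_filter.mp hj).1⟩)
    · exact fun i _ => 𝒜.algebraMap_mem (c i)
    · intro z
      rw [← h z]
      exact Finset.sum_filter_add_sum_filter_not S _ _
  -- If a single class remains, every `exp (p i - p j)` is a quotient from `𝒜` and all differences
  -- are constant. Otherwise the class of `k` is a shorter vanishing sum.
  by_cases hTeq : T = S
  · have hall : ∀ s, ∃ a ∈ 𝒜, ∃ b ∈ 𝒜, b ≠ 0 ∧ ∀ z, Complex.exp (u s z) * b z = a z := by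
      intro s
      have h1 : (s.1 : ι) ∈ T := by rw [hTeq]; exact s.1.2
      have h2 : (s.2 : ι) ∈ T := by rw [hTeq]; exact s.2.2
      obtain ⟨a, ha, b, hb, ha0, hb0, hab⟩ := (Finset.mem_filter.mp h1).2
      obtain ⟨a', ha', b', hb', ha0', hb0', hab'⟩ := (Finset.mem_filter.mp h2).2
      refine ⟨a * b', 𝒜.mul_mem ha hb', b * a', 𝒜.mul_mem hb ha',
        entire_mul_ne_zero hb.1 ha'.1 hb0 ha0', fun z => ?_⟩
      simp only [u, Pi.sub_apply, Pi.mul_apply, Complex.exp_sub]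
      have e1 := hab z
      have e2 := hab' z
      rw [div_mul_eq_mul_div, div_eq_iff (Complex.exp_ne_zero _)]
      have := Complex.exp_ne_zero (p k z)
      apply mul_left_cancel₀ this
      linear_combination Complex.exp (p k z) * a' z * e1 - Complex.exp (p k z) * a z * e2
    obtain ⟨B, hB⟩ := exists_reMax_le hu hall
    have hcard : ∃ i ∈ S, i ≠ k := by
      by_contra! hcon
      have hS : S = {k} := by
        ext i; simp only [Finset.mem_singleton]
        exact ⟨hcon i, fun hi => hi ▸ hk⟩
      have := h 0
      rw [hS, Finset.sum_singleton] at this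
      exact mul_ne_zero (hc k hk) (Complex.exp_ne_zero _) this
    obtain ⟨i, hi, hik⟩ := hcard
    exact ⟨i, hi, hik, fun z w => eq_of_reMax_le hu hB (⟨i, hi⟩, ⟨k, hk⟩) z w⟩
  · obtain ⟨i, hi, h'⟩ := ih T.card (Finset.card_lt_card (hTS.ssubset_of_ne hTeq)) T
      (fun i hi => hc i (hTS hi)) hT hkT rfl
    exact ⟨i, hTS hi, h'⟩

/-! ### Extension of quotients across codimension two -/

theorem differentiableAt_circleAverage_comp_add_smul {E : Type*} [NormedAddCommGroup E]
    [NormedSpace ℂ E] {Ω : Set E} {l : E → ℂ}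
    (hl : AnalyticOnNhd ℂ l Ω) (hΩ : IsOpen Ω) (v : E) {ε : ℝ} (hε : 0 ≤ ε) {w₀ : E}
    (hw : ∀ τ : ℂ, ‖τ‖ = ε → w₀ + τ • v ∈ Ω) :
    DifferentiableAt ℂ (fun w => circleAverage (fun τ => l (w + τ • v)) 0 ε) w₀ := by
  have hK : IsCompact (sphere (0 : ℂ) ε) := isCompact_sphere _ _
  have hw' : ∀ τ ∈ sphere (0 : ℂ) ε, w₀ + τ • v ∈ Ω := fun τ hτ => hw τ (by simpa using hτ)
  have hcont : ContinuousOn (fun x => fderiv ℂ l x) Ω := hl.fderiv.continuousOn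
  have hcK : ContinuousOn (fun τ : ℂ => fderiv ℂ l (w₀ + τ • v)) (sphere 0 ε) :=
    hcont.comp (by fun_prop) hw'
  obtain ⟨C, hC⟩ := hK.exists_bound_of_continuousOn hcK
  have hev : ∀ᶠ w in 𝓝 w₀, ∀ τ ∈ sphere (0 : ℂ) ε, w + τ • v ∈ Ω ∧
      ‖fderiv ℂ l (w + τ • v)‖ < C + 1 := by
    apply hK.eventually_forall_of_forall_eventually
    intro τ hτ
    have hc : ContinuousAt (fun q : E × ℂ => q.1 + q.2 • v) (w₀, τ) := by fun_prop
    have h1 : ∀ᶠ x in 𝓝 (w₀ + τ • v), x ∈ Ω ∧ ‖fderiv ℂ l x‖ < C + 1 := by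
      refine Eventually.and (hΩ.mem_nhds (hw' τ hτ)) ?_
      have := ((hcont.continuousAt (hΩ.mem_nhds (hw' τ hτ))).norm)
      exact this.eventually_lt continuousAt_const (by linarith [hC τ hτ])
    exact hc.eventually h1
  have hmem : ∀ θ, circleMap 0 ε θ ∈ sphere (0 : ℂ) ε := fun θ => circleMap_mem_sphere 0 hε θ
  simp only [circleAverage_def]
  have hF : ∀ w, (∀ τ ∈ sphere (0 : ℂ) ε, w + τ • v ∈ Ω ∧ ‖fderiv ℂ l (w + τ • v)‖ < C + 1) →
      Continuous fun θ => l (w + circleMap 0 ε θ • v) := fun w hw =>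
    hl.continuousOn.comp_continuous (by fun_prop) fun θ => (hw _ (hmem θ)).1
  have := intervalIntegral.hasFDerivAt_integral_of_dominated_of_fderiv_le (𝕜 := ℂ)
    (μ := MeasureTheory.volume) (a := 0) (b := 2 * π) (x₀ := w₀) (bound := fun _ => C + 1)
    (F := fun w θ => l (w + circleMap 0 ε θ • v))
    (F' := fun w θ => fderiv ℂ l (w + circleMap 0 ε θ • v)) hev
    (hev.mono fun w hw => (hF w hw).aestronglyMeasurable)
    ((hF w₀ hev.self_of_nhds).intervalIntegrable _ _)
    (Continuous.aestronglyMeasurable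
      (hcont.comp_continuous (by fun_prop) fun θ => hw' _ (hmem θ)))
    (Eventually.of_forall fun θ _ w hw => (hw _ (hmem θ)).2.le)
    (continuous_const.intervalIntegrable _ _)
    (Eventually.of_forall fun θ _ w hw => by
      have h1 := (hl _ (hw _ (hmem θ)).1).differentiableAt.hasFDerivAt
      exact (hasFDerivAt_comp_add_right _).mpr h1)
  exact this.differentiableAt.const_smul _

/-- The quotient of two proportional holomorphic vector functions, the common zero set of the
first of which has codimension at least two, extends holomorphically. -/
theorem exists_differentiable_quotient {m k : ℕ} {I : Set (Cn m)} {z : Cn m}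
    {G G' : Cn m → Fin k → ℂ} (hG : AnalyticAt ℂ G z) (hG' : AnalyticAt ℂ G' z)
    (hI : ∀ᶠ w in 𝓝 z, (w ∈ I ↔ G w = 0))
    (hprop : ∀ᶠ w in 𝓝 z, w ∉ I → ∃ c : ℂ, G' w = c • G w)
    (hcodim : z ∈ I → CodimGETwoAt I z) :
    ∃ l : Cn m → ℂ, (∀ᶠ w in 𝓝 z, DifferentiableAt ℂ l w) ∧
      ∀ᶠ w in 𝓝 z, G' w = l w • G w := by
  classical
  obtain ⟨ρ, hρ, hV⟩ := eventually_nhds_iff_ball.mp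
    (hG.eventually_analyticAt.and (hG'.eventually_analyticAt.and (hI.and hprop)))
  set V := ball z ρ
  have hVo : IsOpen V := isOpen_ball
  let l₀ : Cn m → ℂ := fun w => if h : ∃ c : ℂ, G' w = c • G w then h.choose else 0
  have hl₀ : ∀ w ∈ V, w ∉ I → G' w = l₀ w • G w := by
    intro w hw hwI
    have h := (hV w hw).2.2.2 hwI
    simp only [l₀, dif_pos h]
    exact h.choose_spec
  let Ω := V ∩ Iᶜ
  have hΩ : IsOpen Ω := by
    rw [isOpen_iff_mem_nhds]
    rintro w ⟨hw, hwI⟩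
    have hne : G w ≠ 0 := fun h => hwI ((hV w hw).2.2.1.mpr h)
    filter_upwards [hVo.mem_nhds hw, (hV w hw).1.continuousAt.eventually_ne hne] with x hx hx'
    exact ⟨hx, fun hxI => hx' ((hV x hx).2.2.1.mp hxI)⟩
  have hlan : AnalyticOnNhd ℂ l₀ Ω := by
    rintro w ⟨hw, hwI⟩
    have hne : G w ≠ 0 := fun h => hwI ((hV w hw).2.2.1.mpr h)
    obtain ⟨i, hi⟩ := Function.ne_iff.mp hne
    have hGi : AnalyticAt ℂ (fun x => G x i) w := analyticAt_pi_iff.mp (hV w hw).1 i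
    have hGi' : AnalyticAt ℂ (fun x => G' x i) w := analyticAt_pi_iff.mp (hV w hw).2.1 i
    refine (hGi'.div hGi hi).congr ?_
    filter_upwards [hΩ.mem_nhds ⟨hw, hwI⟩, hGi.continuousAt.eventually_ne hi] with x hx hx'
    have := congrFun (hl₀ x hx.1 hx.2) i
    simp only [Pi.smul_apply, smul_eq_mul] at this
    simp only [Pi.div_apply]
    rw [this, mul_div_cancel_right₀ _ hx']
  by_cases hzI : z ∉ I
  · have hz : z ∈ Ω := ⟨mem_ball_self hρ, hzI⟩
    exact ⟨l₀, by filter_upwards [hΩ.mem_nhds hz] with w hw using (hlan w hw).differentiableAt,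
      by filter_upwards [hΩ.mem_nhds hz] with w hw using hl₀ w hw.1 hw.2⟩
  rw [not_not] at hzI
  obtain ⟨P, hP, hPI⟩ := hcodim hzI
  let B := Module.finBasisOfFinrankEq ℂ P hP
  let v₁ : Cn m := B 0
  let v₂ : Cn m := B 1
  have hindep : ∀ s t : ℂ, s • v₁ + t • v₂ = 0 → s = 0 ∧ t = 0 := by
    intro s t h
    have h' : s • B 0 + t • B 1 = 0 := Subtype.ext h
    have := Fintype.linearIndependent_iff.mp B.linearIndependent ![s, t]
      (by simpa [Fin.sum_univ_two] using h')
    exact ⟨this 0, this 1⟩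
  let A : ℂ × ℂ → Cn m := fun k => k.1 • v₁ + k.2 • v₂
  have hA : Continuous A := by fun_prop
  have hA0 : A 0 = 0 := by simp [A]
  have hev : ∀ᶠ k in 𝓝 (0 : ℂ × ℂ), z + A k ∈ V ∧ (z + A k ∈ I → k = 0) := by
    have hc : Tendsto (fun k => z + A k) (𝓝 0) (𝓝 z) := by
      have : Continuous fun k => z + A k := by fun_prop
      simpa [hA0] using this.tendsto 0
    filter_upwards [hc.eventually (hVo.mem_nhds (mem_ball_self hρ)), hc.eventually hPI] with k h1 h2
    refine ⟨h1, fun h => ?_⟩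
    have hmem : z + A k - z ∈ P := by
      rw [add_sub_cancel_left]
      exact P.add_mem (P.smul_mem _ (B 0).2) (P.smul_mem _ (B 1).2)
    have := h2 h hmem
    obtain ⟨h3, h4⟩ := hindep k.1 k.2 (by simpa [A] using this)
    exact Prod.ext h3 h4
  obtain ⟨ε, hε, hball⟩ := nhds_basis_closedBall.eventually_iff.mp hev
  let Q := closedBall (0 : ℂ × ℂ) ε
  -- The boundary of a bidisc in a plane meeting `I` only at `z`. By compactness its translates to
  -- nearby points `w` still avoid `I`.
  let K := Q ∩ {k | ‖k.1‖ = ε ∨ ‖k.2‖ = ε}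
  have hQ : IsCompact Q := isCompact_closedBall _ _
  have hK : IsCompact K := hQ.inter_right
    ((isClosed_eq (by fun_prop) continuous_const).union (isClosed_eq (by fun_prop) continuous_const))
  have hQmem : ∀ s t : ℂ, ‖s‖ ≤ ε → ‖t‖ ≤ ε → (s, t) ∈ Q := by
    intro s t hs ht
    simp [Q, Prod.norm_def, hs, ht]
  have hcA : ∀ k, ContinuousAt (fun q : Cn m × (ℂ × ℂ) => q.1 + A q.2) (z, k) := by
    intro k; fun_prop
  have hev1 : ∀ᶠ w in 𝓝 z, ∀ k ∈ Q, w + A k ∈ V := by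
    apply hQ.eventually_forall_of_forall_eventually
    intro k hk
    exact (hcA k).eventually (hVo.mem_nhds (hball hk).1)
  have hev2 : ∀ᶠ w in 𝓝 z, ∀ k ∈ K, w + A k ∈ Ω := by
    apply hK.eventually_forall_of_forall_eventually
    rintro k ⟨hk, hk'⟩
    refine (hcA k).eventually (hΩ.mem_nhds ⟨(hball hk).1, fun hkI => ?_⟩)
    have := (hball hk).2 hkI
    subst this
    rcases hk' with h | h <;> simp at h <;> linarith
  -- The average over circles in direction `v₂` is holomorphic, because these circles avoid `I`, and
  -- equals `l₀` wherever the whole `v₂`-disc avoids `I`, by the mean value property.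
  let l : Cn m → ℂ := fun w => circleAverage (fun τ => l₀ (w + τ • v₂)) 0 ε
  have hldiff : ∀ w, (∀ k ∈ K, w + A k ∈ Ω) → ∀ s : ℂ, ‖s‖ ≤ ε →
      DifferentiableAt ℂ l (w + s • v₁) := by
    intro w hw s hs
    refine differentiableAt_circleAverage_comp_add_smul hlan hΩ v₂ hε.le fun τ hτ => ?_
    have := hw (s, τ) ⟨hQmem _ _ hs hτ.le, Or.inr hτ⟩
    simpa [A, add_assoc] using this
  refine ⟨l, hev2.mono fun w hw => by simpa using hldiff w hw 0 (by simpa using hε.le), ?_⟩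
  filter_upwards [hev1, hev2] with w hw1 hw2
  have hVs : ∀ s : ℂ, ‖s‖ ≤ ε → w + s • v₁ ∈ V := fun s hs => by
    simpa [A] using hw1 (s, 0) (hQmem _ _ hs (by simpa using hε.le))
  have hcl : closure (ball (0 : ℂ) ε) = closedBall 0 ε := closure_ball _ hε.ne'
  -- On the `v₁`-disc through `w`, `G' = l • G` is known on the boundary circle; the maximum
  -- principle extends it to the centre.
  have key := Complex.eqOn_of_eqOn_frontier (U := ball (0 : ℂ) ε)
    (f := fun s => G' (w + s • v₁)) (g := fun s => l (w + s • v₁) • G (w + s • v₁))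
    isBounded_ball ?_ ?_ ?_
  · simpa using key (mem_ball_self hε)
  · apply DifferentiableOn.diffContOnCl
    rw [hcl]
    intro s hs
    have hs : ‖s‖ ≤ ε := by simpa using hs
    have h1 := (hV _ (hVs s hs)).2.1.differentiableAt
    exact (h1.comp s (f := fun s : ℂ => w + s • v₁) (by fun_prop)).differentiableWithinAt
  · apply DifferentiableOn.diffContOnCl
    rw [hcl]
    intro s hs
    have hs : ‖s‖ ≤ ε := by simpa using hs
    have h1 := (hV _ (hVs s hs)).1.differentiableAt
    have h2 := hldiff w hw2 s hs
    exact ((h2.smul h1).comp s (f := fun s : ℂ => w + s • v₁)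
      (by fun_prop)).differentiableWithinAt
  · intro s hs
    rw [frontier_ball _ hε.ne'] at hs
    have hs : ‖s‖ = ε := by simpa using hs
    have hΩs : ∀ t : ℂ, ‖t‖ ≤ ε → w + s • v₁ + t • v₂ ∈ Ω := fun t ht => by
      have := hw2 (s, t) ⟨hQmem _ _ hs.le ht, Or.inl hs⟩
      simpa [A, add_assoc] using this
    have hmv : l (w + s • v₁) = l₀ (w + s • v₁) := by
      have hd : DiffContOnCl ℂ (fun τ : ℂ => l₀ (w + s • v₁ + τ • v₂)) (ball 0 |ε|) := by
        apply DifferentiableOn.diffContOnCl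
        rw [abs_of_pos hε, hcl]
        intro t ht
        have h1 := (hlan _ (hΩs t (by simpa using ht))).differentiableAt
        exact (h1.comp t (f := fun t : ℂ => w + s • v₁ + t • v₂)
          (by fun_prop)).differentiableWithinAt
      have := hd.circleAverage
      simpa using this
    have h0 := hΩs 0 (by simpa using hε.le)
    rw [zero_smul, add_zero] at h0
    simp only [hmv]
    exact hl₀ _ h0.1 h0.2

/-! ### Reduced representations and entire ratios -/

open Matrix

theorem CodimGETwoAt.frequently_notMem {m : ℕ} {A : Set (Cn m)} {z : Cn m}
    (h : CodimGETwoAt A z) : ∃ᶠ w in 𝓝 z, w ∉ A := by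
  obtain ⟨P, hP, hA⟩ := h
  obtain ⟨v, hv, hv0⟩ := P.exists_mem_ne_zero_of_ne_bot (by rintro rfl; simp at hP)
  have hc : Tendsto (fun t : ℂ => z + t • v) (𝓝[≠] 0) (𝓝 z) := by
    have : Continuous fun t : ℂ => z + t • v := by fun_prop
    simpa using (this.tendsto 0).mono_left nhdsWithin_le_nhds
  refine hc.frequently (Eventually.frequently ?_)
  filter_upwards [hc.eventually hA, self_mem_nhdsWithin] with t ht ht0 htA
  have := ht htA (by rw [add_sub_cancel_left]; exact P.smul_mem _ hv)
  simp only [add_eq_left, smul_eq_zero] at this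
  exact this.elim ht0 hv0

theorem IsReducedRepAt.frequently_ne_zero {m n : ℕ} {f : MeroMap m n} {z : Cn m}
    {F : Cn m → Fin (n + 1) → ℂ} (hF : IsReducedRepAt f.indet f.toFun z F) :
    ∃ᶠ w in 𝓝 z, F w ≠ 0 := by
  by_cases hz : z ∈ f.indet
  · exact ((f.codim_indet z hz).frequently_notMem.and_eventually hF.2).mono
      fun w hw h => hw.1 (hw.2.1.mpr h)
  · have : F z ≠ 0 := fun h => hz (hF.2.self_of_nhds.1.mpr h)
    exact (hF.1.continuousAt.eventually_ne this).frequently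

/-- Two reduced representations differ by a holomorphic unit. -/
theorem IsReducedRepAt.exists_unit {m n : ℕ} {f : MeroMap m n} {z : Cn m}
    {F F' : Cn m → Fin (n + 1) → ℂ} (hF : IsReducedRepAt f.indet f.toFun z F)
    (hF' : IsReducedRepAt f.indet f.toFun z F') :
    ∃ l : Cn m → ℂ, (∀ᶠ w in 𝓝 z, DifferentiableAt ℂ l w) ∧ l z ≠ 0 ∧
      ∀ᶠ w in 𝓝 z, F' w = l w • F w := by
  have key : ∀ {F F' : Cn m → Fin (n + 1) → ℂ}, IsReducedRepAt f.indet f.toFun z F →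
      IsReducedRepAt f.indet f.toFun z F' → ∃ l : Cn m → ℂ,
      (∀ᶠ w in 𝓝 z, DifferentiableAt ℂ l w) ∧ ∀ᶠ w in 𝓝 z, F' w = l w • F w := by
    intro F F' hF hF'
    refine exists_differentiable_quotient hF.1 hF'.1 (hF.2.mono fun w h => h.1) ?_
      (f.codim_indet z)
    filter_upwards [hF.2, hF'.2] with w h h' hw
    have h1 : F w ≠ 0 := fun h0 => hw (h.1.mpr h0)
    have h2 : F' w ≠ 0 := fun h0 => hw (h'.1.mpr h0)
    have := (h'.2 hw h2).symm.trans (h.2 hw h1)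
    rw [Projectivization.mk_eq_mk_iff'] at this
    obtain ⟨c, hc⟩ := this
    exact ⟨c, hc.symm⟩
  obtain ⟨l, hl, hlF⟩ := key hF hF'
  obtain ⟨l', hl', hlF'⟩ := key hF' hF
  refine ⟨l, hl, fun hlz => ?_, hlF⟩
  have hc : ContinuousAt (fun w => l' w * l w) z :=
    (hl'.self_of_nhds.continuousAt).mul hl.self_of_nhds.continuousAt
  -- The two quotients are mutually inverse wherever `F ≠ 0`, and such points accumulate at `z`, so
  -- `l z = 0` is impossible.
  have hne : ∀ᶠ w in 𝓝 z, l' w * l w ≠ 1 := hc.eventually_ne (by simp [hlz])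
  obtain ⟨w, hw, hw1, hw2, hw3⟩ :=
    (hF.frequently_ne_zero.and_eventually (hne.and (hlF.and hlF'))).exists
  rw [hw2, smul_smul] at hw3
  have : (1 - l' w * l w) • F w = 0 := by rw [sub_smul, one_smul, ← hw3, sub_self]
  exact hw1 (sub_eq_zero.mp ((smul_eq_zero.mp this).resolve_right hw)).symm

open Classical in
/-- A vector representing the value `f(z)`, zero on the indeterminacy locus. -/
noncomputable def MeroMap.vec {m n : ℕ} (f : MeroMap m n) (z : Cn m) : Fin (n + 1) → ℂ :=
  if h : z ∉ f.indet then (f.toFun z h).rep else 0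

theorem IsReducedRepAt.eventually_eq_smul_vec {m n : ℕ} {f : MeroMap m n} {z : Cn m}
    {F : Cn m → Fin (n + 1) → ℂ} (hF : IsReducedRepAt f.indet f.toFun z F) :
    ∀ᶠ w in 𝓝 z, ∃ c : ℂ, c ≠ 0 ∧ F w = c • f.vec w := by
  filter_upwards [hF.2] with w hw
  by_cases h : w ∈ f.indet
  · exact ⟨1, one_ne_zero, by rw [hw.1.mp h, MeroMap.vec, dif_neg (not_not.mpr h), smul_zero]⟩
  · have h0 : F w ≠ 0 := fun h0 => h (hw.1.mpr h0)
    obtain ⟨c, hc⟩ := Projectivization.exists_smul_eq_mk_rep ℂ (F w) h0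
    refine ⟨(c⁻¹ : ℂˣ), Units.ne_zero _, ?_⟩
    rw [MeroMap.vec, dif_pos h, hw.2 h h0, ← hc]
    change F w = (c⁻¹ : ℂˣ) • c • F w
    rw [inv_smul_smul]

theorem MeroMap.isOpen_vec_ne {m n : ℕ} (f : MeroMap m n) (a : Fin (n + 1) → ℂ) :
    IsOpen {w | a ⬝ᵥ f.vec w ≠ 0} := by
  rw [isOpen_iff_mem_nhds]
  intro z hz
  obtain ⟨F, hF⟩ := f.exists_rep z
  have hev := hF.eventually_eq_smul_vec
  have hcont : ContinuousAt (fun w => a ⬝ᵥ F w) z := by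
    have : Continuous fun v : Fin (n + 1) → ℂ => a ⬝ᵥ v := by
      unfold dotProduct; fun_prop
    exact this.continuousAt.comp hF.1.continuousAt
  obtain ⟨c, hc, hFz⟩ := hev.self_of_nhds
  have hne : a ⬝ᵥ F z ≠ 0 := by
    rw [hFz, dotProduct_smul]; exact mul_ne_zero hc hz
  filter_upwards [hcont.eventually_ne hne, hev] with w hw ⟨d, _, hd⟩ h0
  rw [hd, dotProduct_smul, h0, smul_zero] at hw
  exact hw rfl

/-- The interior of the zero set is closed, by the identity theorem on balls carrying a reduced
representation. As `ℂ^m` is connected it is empty or everything, and the latter puts the image into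
the hyperplane. -/
theorem MeroMap.dense_vec_ne {m n : ℕ} (f : MeroMap m n) (a : Fin (n + 1) → ℂ)
    (h : ¬ f.image ⊆ hyperplane a) : Dense {w | a ⬝ᵥ f.vec w ≠ 0} := by
  set E := {w | a ⬝ᵥ f.vec w ≠ 0} with hE
  have hclopen : IsClopen (interior Eᶜ) := by
    refine ⟨?_, isOpen_interior⟩
    rw [← isOpen_compl_iff, isOpen_iff_mem_nhds]
    intro z hz
    obtain ⟨F, hF⟩ := f.exists_rep z
    obtain ⟨ρ, hρ, hball⟩ := eventually_nhds_iff_ball.mp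
      (hF.1.eventually_analyticAt.and hF.eventually_eq_smul_vec)
    filter_upwards [ball_mem_nhds z hρ] with z' hz' hz'E
    apply hz
    have han : AnalyticOnNhd ℂ (fun w => a ⬝ᵥ F w) (ball z ρ) := by
      intro w hw
      simp only [dotProduct]
      exact Finset.analyticAt_fun_sum _ fun i _ =>
        analyticAt_const.mul (analyticAt_pi_iff.mp (hball w hw).1 i)
    have hzero := han.eqOn_zero_of_preconnected_of_eventuallyEq_zero
      (convex_ball z ρ).isPreconnected hz' (by
        filter_upwards [mem_interior_iff_mem_nhds.mp hz'E, isOpen_ball.mem_nhds hz'] with w hw hwb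
        obtain ⟨c, -, hc⟩ := (hball w hwb).2
        have : a ⬝ᵥ f.vec w = 0 := not_not.mp hw
        simp [hc, this])
    rw [mem_interior_iff_mem_nhds]
    filter_upwards [ball_mem_nhds z hρ] with w hw hwE
    obtain ⟨c, hc0, hc⟩ := (hball w hw).2
    have := hzero hw
    simp only [hc, dotProduct_smul, Pi.zero_apply, smul_eq_mul, mul_eq_zero] at this
    exact hwE (this.resolve_left hc0)
  rcases isClopen_iff.mp hclopen with h0 | h1
  · rwa [interior_eq_empty_iff_dense_compl, compl_compl] at h0
  · exfalso
    apply h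
    rintro _ ⟨z, hz, rfl⟩
    have : z ∈ Eᶜ := interior_subset (h1 ▸ mem_univ z)
    have : a ⬝ᵥ f.vec z = 0 := not_not.mp this
    rwa [MeroMap.vec, dif_pos hz] at this

/-- Local comparison of the linear forms of two maps with the same pullback divisors. -/
theorem exists_local_units {m n N : ℕ} {ι : Type*} {a : ι → Fin (n + 1) → ℂ}
    {b : ι → Fin (N + 1) → ℂ} {f : MeroMap m n} {g : MeroMap m N}
    (hfg : ∀ j, f.pullbackDivisor (a j) = g.pullbackDivisor (b j)) (z : Cn m) :
    ∃ F G, IsReducedRepAt f.indet f.toFun z F ∧ IsReducedRepAt g.indet g.toFun z G ∧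
      ∃ u : ι → Cn m → ℂ, ∀ j, (∀ᶠ w in 𝓝 z, DifferentiableAt ℂ (u j) w) ∧ u j z ≠ 0 ∧
        ∀ᶠ w in 𝓝 z, a j ⬝ᵥ F w = u j w * (b j ⬝ᵥ G w) := by
  obtain ⟨F, hF⟩ := f.exists_rep z
  obtain ⟨G, hG⟩ := g.exists_rep z
  refine ⟨F, G, hF, hG, ?_⟩
  have : ∀ j, ∃ u : Cn m → ℂ, (∀ᶠ w in 𝓝 z, DifferentiableAt ℂ u w) ∧ u z ≠ 0 ∧
        ∀ᶠ w in 𝓝 z, a j ⬝ᵥ F w = u w * (b j ⬝ᵥ G w) := by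
    intro j
    have hmem : (fun w => a j ⬝ᵥ F w) ∈ f.pullbackDivisor (a j) z :=
      ⟨F, hF, fun _ => 1, analyticAt_const, one_ne_zero,
        Eventually.of_forall fun w => (one_mul _).symm⟩
    rw [hfg] at hmem
    obtain ⟨G', hG', v, hv, hvz, hvG⟩ := hmem
    obtain ⟨l, hl, hlz, hlG⟩ := hG.exists_unit hG'
    refine ⟨fun w => v w * l w, ?_, mul_ne_zero hvz hlz, ?_⟩
    · filter_upwards [hv.eventually_analyticAt, hl] with w h1 h2
      exact h1.differentiableAt.mul h2
    · filter_upwards [hvG, hlG] with w h1 h2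
      rw [h1]
      change v w * (b j ⬝ᵥ G' w) = _
      rw [h2, dotProduct_smul, smul_eq_mul, mul_assoc]
  choose u hu using this
  exact ⟨u, hu⟩

/-- The ratios of the linear forms of two maps with the same pullback divisors are, up to a common
factor, nowhere vanishing entire functions. -/
theorem exists_entire_ratios {m n N : ℕ} {ι : Type*} [Finite ι] {a : ι → Fin (n + 1) → ℂ}
    {b : ι → Fin (N + 1) → ℂ} {f : MeroMap m n} {g : MeroMap m N} (j₀ : ι)
    (hf : ∀ j, ¬ f.image ⊆ hyperplane (a j)) (hg : ∀ j, ¬ g.image ⊆ hyperplane (b j))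
    (hfg : ∀ j, f.pullbackDivisor (a j) = g.pullbackDivisor (b j)) :
    ∃ ψ : ι → Cn m → ℂ, (∀ j, Differentiable ℂ (ψ j)) ∧ (∀ j z, ψ j z ≠ 0) ∧
      ∀ z, ∃ F G, IsReducedRepAt f.indet f.toFun z F ∧ IsReducedRepAt g.indet g.toFun z G ∧
        ∃ u : Cn m → ℂ, ∀ᶠ w in 𝓝 z, u w ≠ 0 ∧ ∀ j, a j ⬝ᵥ F w = u w * ψ j w * (b j ⬝ᵥ G w) := by
  let E : Set (Cn m) := (⋂ j, {w | a j ⬝ᵥ f.vec w ≠ 0}) ∩ ⋂ j, {w | b j ⬝ᵥ g.vec w ≠ 0}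
  have hE : Dense E := by
    have h1 : Dense (⋂ j, {w | a j ⬝ᵥ f.vec w ≠ 0}) :=
      dense_iInter_of_isOpen (fun j => f.isOpen_vec_ne _) fun j => f.dense_vec_ne _ (hf j)
    have h2 : Dense (⋂ j, {w | b j ⬝ᵥ g.vec w ≠ 0}) :=
      dense_iInter_of_isOpen (fun j => g.isOpen_vec_ne _) fun j => g.dense_vec_ne _ (hg j)
    exact h1.inter_of_isOpen_left h2 (isOpen_iInter_of_finite fun j => f.isOpen_vec_ne _)
  -- Dividing by the ratio at `j₀` cancels the arbitrary scalings of `f.vec` and `g.vec`. On the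
  -- dense set `E` this equals the local quotient `u j / u j₀`, so the continuous extension is
  -- holomorphic and nowhere zero.
  let Q : ι → Cn m → ℂ := fun j w =>
    (a j ⬝ᵥ f.vec w) * (b j₀ ⬝ᵥ g.vec w) / ((b j ⬝ᵥ g.vec w) * (a j₀ ⬝ᵥ f.vec w))
  have hloc : ∀ z, ∃ F G, IsReducedRepAt f.indet f.toFun z F ∧
      IsReducedRepAt g.indet g.toFun z G ∧ ∃ u : ι → Cn m → ℂ, (∀ᶠ w in 𝓝 z, ∀ j,
        DifferentiableAt ℂ (u j) w ∧ u j w ≠ 0 ∧ a j ⬝ᵥ F w = u j w * (b j ⬝ᵥ G w)) ∧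
        ∀ᶠ w in 𝓝 z, ∀ j, extendFrom E (Q j) w = u j w / u j₀ w := by
    intro z
    obtain ⟨F, G, hF, hG, u, hu⟩ := exists_local_units hfg z
    have hev : ∀ᶠ w in 𝓝 z, ∀ j,
        DifferentiableAt ℂ (u j) w ∧ u j w ≠ 0 ∧ a j ⬝ᵥ F w = u j w * (b j ⬝ᵥ G w) := by
      rw [eventually_all]
      intro j
      obtain ⟨h1, h2, h3⟩ := hu j
      exact h1.and ((h1.self_of_nhds.continuousAt.eventually_ne h2).and h3)
    refine ⟨F, G, hF, hG, u, hev, ?_⟩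
    have hQ : ∀ᶠ w in 𝓝 z, w ∈ E → ∀ j, Q j w = u j w / u j₀ w := by
      filter_upwards [hev, hF.eventually_eq_smul_vec, hG.eventually_eq_smul_vec]
        with w hw ⟨c, hc, hFw⟩ ⟨d, hd, hGw⟩ hwE j
      have hE1 : ∀ j, a j ⬝ᵥ f.vec w ≠ 0 := fun j => mem_iInter.mp hwE.1 j
      have hE2 : ∀ j, b j ⬝ᵥ g.vec w ≠ 0 := fun j => mem_iInter.mp hwE.2 j
      have e : ∀ j, c * (a j ⬝ᵥ f.vec w) = u j w * (d * (b j ⬝ᵥ g.vec w)) := by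
        intro j
        have := (hw j).2.2
        rwa [hFw, hGw, dotProduct_smul, dotProduct_smul] at this
      have e1 := e j
      have e2 := e j₀
      simp only [Q]
      rw [div_eq_div_iff (mul_ne_zero (hE2 j) (hE1 j₀)) (hw j₀).2.1]
      apply mul_left_cancel₀ (mul_ne_zero hc hd)
      linear_combination d * (b j₀ ⬝ᵥ g.vec w) * u j₀ w * e1 - u j w * d * (b j ⬝ᵥ g.vec w) * e2
    filter_upwards [hev.eventually_nhds, hQ.eventually_nhds] with w hw hwQ j
    apply extendFrom_eq (hE w)
    have h1 := hw.self_of_nhds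
    have hc : ContinuousAt (fun x => u j x / u j₀ x) w :=
      ((h1 j).1.continuousAt).div (h1 j₀).1.continuousAt (h1 j₀).2.1
    refine (hc.tendsto.mono_left nhdsWithin_le_nhds).congr' ?_
    rw [EventuallyEq, eventually_nhdsWithin_iff]
    filter_upwards [hwQ] with x hx hxE
    exact (hx hxE j).symm
  refine ⟨fun j => extendFrom E (Q j), fun j z => ?_, fun j z => ?_, fun z => ?_⟩
  · obtain ⟨F, G, hF, hG, u, hu, hψ⟩ := hloc z
    have h1 := hu.self_of_nhds
    refine DifferentiableAt.congr_of_eventuallyEq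
      ((h1 j).1.fun_mul ((h1 j₀).1.fun_inv (h1 j₀).2.1)) ?_
    filter_upwards [hψ] with w hw
    rw [hw j, div_eq_mul_inv]
  · obtain ⟨F, G, hF, hG, u, hu, hψ⟩ := hloc z
    have h1 := hu.self_of_nhds
    simp only [hψ.self_of_nhds j]
    exact div_ne_zero (h1 j).2.1 (h1 j₀).2.1
  · obtain ⟨F, G, hF, hG, u, hu, hψ⟩ := hloc z
    refine ⟨F, G, hF, hG, u j₀, ?_⟩
    filter_upwards [hu, hψ] with w h1 h2
    refine ⟨(h1 j₀).2.1, fun j => ?_⟩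
    rw [h2 j, mul_div_cancel₀ _ (h1 j₀).2.1, (h1 j).2.2]

theorem InGeneralPosition.eq_zero_of_sum_eq_zero {n q : ℕ} {a : Fin q → Fin (n + 1) → ℂ}
    (ha : InGeneralPosition a) {κ : Type*} {r : κ → Fin q} (hr : Function.Injective r)
    {s : Finset κ} (hs : s.card ≤ n + 1) {x : κ → ℂ} (h : ∑ i ∈ s, x i • a (r i) = 0) :
    ∀ i ∈ s, x i = 0 := by
  have h1 := ha (s.map ⟨r, hr⟩) (by simpa using hs)
  have h2 := h1.comp (fun i : s => ⟨r i, Finset.mem_map_of_mem ⟨r, hr⟩ i.2⟩) (fun i j hij =>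
    Subtype.ext (hr (congrArg Subtype.val hij)))
  intro i hi
  refine Fintype.linearIndependent_iff.mp h2 (fun i => x i) ?_ ⟨i, hi⟩
  rw [← h]
  exact Finset.sum_coe_sort s fun i => x i • a (r i)

/-! ### Expansion of the elimination determinant -/

section mixed

variable {n N : ℕ}

/-- The row `(a | 0)`. -/
def leftRow (a : Fin (n + 1) → ℂ) : Fin (n + 1) ⊕ Fin (N + 1) → ℂ := Sum.elim a 0

/-- The row `(0 | b)`. -/
def rightRow (b : Fin (N + 1) → ℂ) : Fin (n + 1) ⊕ Fin (N + 1) → ℂ := Sum.elim 0 b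

open Classical in
/-- The determinant with rows `(0 | bᵢ)` for `i ∈ s` and `(aᵢ | 0)` for `i ∉ s`. -/
noncomputable def mixedDet (a : Fin (n + 1) ⊕ Fin (N + 1) → Fin (n + 1) → ℂ)
    (b : Fin (n + 1) ⊕ Fin (N + 1) → Fin (N + 1) → ℂ) (s : Finset (Fin (n + 1) ⊕ Fin (N + 1))) : ℂ :=
  Matrix.det (Matrix.of (s.piecewise (fun i => rightRow (b i)) fun i => leftRow (a i)))

theorem det_leftRow_add_smul_rightRow (a : Fin (n + 1) ⊕ Fin (N + 1) → Fin (n + 1) → ℂ)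
    (b : Fin (n + 1) ⊕ Fin (N + 1) → Fin (N + 1) → ℂ) (t : Fin (n + 1) ⊕ Fin (N + 1) → ℂ) :
    Matrix.det (Matrix.of fun i => leftRow (a i) + t i • rightRow (b i)) =
      ∑ s : Finset (Fin (n + 1) ⊕ Fin (N + 1)), (∏ i ∈ s, t i) * mixedDet a b s := by
  classical
  have h := (Matrix.detRowAlternating (R := ℂ) (n := Fin (n + 1) ⊕ Fin (N + 1))).map_add_univ
    (fun i => t i • rightRow (b i)) (fun i => leftRow (a i))
  have e : (Matrix.of fun i => leftRow (a i) + t i • rightRow (b i)) =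
      Matrix.of ((fun i => t i • rightRow (b i)) + fun i => leftRow (a i)) := by
    ext i j; simp [add_comm]
  rw [e]
  refine h.trans (Finset.sum_congr rfl fun s _ => ?_)
  have h2 := (Matrix.detRowAlternating (R := ℂ)
    (n := Fin (n + 1) ⊕ Fin (N + 1))).toMultilinearMap.map_piecewise_smul t
    (s.piecewise (fun i => rightRow (b i)) (fun i => leftRow (a i))) s
  have e2 : s.piecewise (fun i => t i • s.piecewise (fun i => rightRow (n := n) (b i))
      (fun i => leftRow (a i)) i) (s.piecewise (fun i => rightRow (b i)) (fun i => leftRow (a i))) =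
      s.piecewise (fun i => t i • rightRow (b i)) fun i => leftRow (a i) := by
    funext i
    by_cases hi : i ∈ s <;> simp [hi]
  rw [e2] at h2
  refine h2.trans ?_
  rw [smul_eq_mul, mixedDet]
  congr 2

/-- After separating the two blocks of columns, a relation between the rows splits into one among `N
+ 1` forms `b` and one among `n + 1` forms `a`, both trivial by general position. -/
theorem mixedDet_ne_zero {q : ℕ} {a : Fin q → Fin (n + 1) → ℂ} {b : Fin q → Fin (N + 1) → ℂ}
    (ha : InGeneralPosition a) (hb : InGeneralPosition b) {r : Fin (n + 1) ⊕ Fin (N + 1) → Fin q}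
    (hr : Function.Injective r) {s : Finset (Fin (n + 1) ⊕ Fin (N + 1))} (hs : s.card = N + 1) :
    mixedDet (fun i => a (r i)) (fun i => b (r i)) s ≠ 0 := by
  classical
  have hs' : sᶜ.card = n + 1 := by
    rw [Finset.card_compl, hs]; simp
  unfold mixedDet
  rw [← isUnit_iff_ne_zero, ← Matrix.isUnit_iff_isUnit_det, ← Matrix.linearIndependent_rows_iff_isUnit,
    Fintype.linearIndependent_iff]
  intro x hx
  have hsplit : ∀ k, ∑ i ∈ s, x i * rightRow (n := n) (b (r i)) k +
      ∑ i ∈ sᶜ, x i * leftRow (N := N) (a (r i)) k = 0 := by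
    intro k
    have := congrFun hx k
    rw [Finset.sum_apply, ← Finset.sum_add_sum_compl s] at this
    refine Eq.trans ?_ this
    congr 1 <;> refine Finset.sum_congr rfl fun i hi => ?_
    · simp [Matrix.row, hi]
    · simp [Matrix.row, Finset.mem_compl.mp hi]
  have h1 := hb.eq_zero_of_sum_eq_zero hr hs.le (x := x) (by
    funext k
    have := hsplit (Sum.inr k)
    simpa [rightRow, leftRow] using this)
  have h2 := ha.eq_zero_of_sum_eq_zero hr hs'.le (x := x) (by
    funext k
    have := hsplit (Sum.inl k)
    simpa [rightRow, leftRow] using this)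
  intro i
  by_cases hi : i ∈ s
  · exact h1 i hi
  · exact h2 i (Finset.mem_compl.mpr hi)

/-- Independent rows allow at most `N + 1` of type `b` and `n + 1` of type `a`, and the total is `n
+ N + 2`. -/
theorem card_eq_of_mixedDet_ne_zero {a : Fin (n + 1) ⊕ Fin (N + 1) → Fin (n + 1) → ℂ}
    {b : Fin (n + 1) ⊕ Fin (N + 1) → Fin (N + 1) → ℂ}
    {s : Finset (Fin (n + 1) ⊕ Fin (N + 1))} (h : mixedDet a b s ≠ 0) : s.card = N + 1 := by
  classical
  unfold mixedDet at h
  have hli := Matrix.linearIndependent_rows_of_det_ne_zero h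
  have h1 : s.card ≤ N + 1 := by
    have h3 : LinearIndependent ℂ (fun i : s => b i) := by
      rw [Fintype.linearIndependent_iff]
      intro x hx
      refine Fintype.linearIndependent_iff.mp (hli.comp (Subtype.val : s → _)
        Subtype.val_injective) x ?_
      funext k
      rw [Finset.sum_apply]
      rcases k with k | k
      · refine Finset.sum_eq_zero fun i _ => ?_
        simp [i.2, rightRow]
      · refine Eq.trans (Finset.sum_congr rfl fun i _ => ?_)
          ((Finset.sum_apply _ _ _).symm.trans (congrFun hx k))
        simp [i.2, rightRow]
    simpa using h3.fintype_card_le_finrank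
  have h2 : sᶜ.card ≤ n + 1 := by
    have h3 : LinearIndependent ℂ (fun i : (sᶜ : Finset _) => a i) := by
      rw [Fintype.linearIndependent_iff]
      intro x hx
      refine Fintype.linearIndependent_iff.mp (hli.comp (Subtype.val : (sᶜ : Finset _) → _)
        Subtype.val_injective) x ?_
      funext k
      rw [Finset.sum_apply]
      rcases k with k | k
      · refine Eq.trans (Finset.sum_congr rfl fun i _ => ?_)
          ((Finset.sum_apply _ _ _).symm.trans (congrFun hx k))
        simp [Finset.mem_compl.mp i.2, leftRow]
      · refine Finset.sum_eq_zero fun i _ => ?_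
        simp [Finset.mem_compl.mp i.2, leftRow]
    simpa only [Fintype.card_coe, Module.finrank_fintype_fun_eq_card, Fintype.card_fin]
      using h3.fintype_card_le_finrank
  rw [Finset.card_compl] at h2
  simp only [Fintype.card_sum, Fintype.card_fin] at h2
  omega

end mixed

/-! ### From Borel's lemma to sums of real numbers -/

theorem exists_log {h : ℂ → ℂ} (hh : Differentiable ℂ h) (h0 : ∀ t, h t ≠ 0) :
    ∃ p : ℂ → ℂ, Differentiable ℂ p ∧ p 0 = 0 ∧ ∀ t, h t = h 0 * Complex.exp (p t) := by
  have hd : Differentiable ℂ fun t => deriv h t / h t := hh.deriv.fun_div hh h0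
  obtain ⟨p, hp0, hp⟩ := hd.isExactOn_univ.with_val_at 0 0
  have hp' : ∀ t, HasDerivAt p (deriv h t / h t) t := fun t => hp t (mem_univ t)
  refine ⟨p, fun t => (hp' t).differentiableAt, hp0, fun t => ?_⟩
  have hq : ∀ t, HasDerivAt (fun t => h t * Complex.exp (-p t)) 0 t := by
    intro t
    refine ((hh t).hasDerivAt.fun_mul (hp' t).neg.cexp).congr_deriv ?_
    have := h0 t
    field_simp
    ring
  have := is_const_of_deriv_eq_zero (fun t => (hq t).differentiableAt) (fun t => (hq t).deriv) t 0
  simp only [hp0, neg_zero, Complex.exp_zero, mul_one] at this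
  rw [← this, mul_assoc, ← Complex.exp_add]
  simp

theorem dense_setOf_ne_of_differentiable {m : ℕ} {h : Cn m → ℂ} (hh : Differentiable ℂ h) (c : ℂ)
    (hc : ∃ z, h z ≠ c) : Dense {w | h w ≠ c} := by
  obtain ⟨z, hz⟩ := hc
  rw [← compl_compl {w | h w ≠ c}, ← interior_eq_empty_iff_dense_compl, eq_empty_iff_forall_notMem]
  intro w hw
  apply hz
  let k : ℂ → ℂ := fun t => h (w + t • (z - w))
  have hk : Differentiable ℂ k := hh.comp (by fun_prop)
  have hev : k =ᶠ[𝓝 0] fun _ => c := by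
    have hcont : ContinuousAt (fun t : ℂ => w + t • (z - w)) 0 := by fun_prop
    have := hcont.eventually (f := fun t : ℂ => w + t • (z - w))
      (p := fun x => x ∈ {w | h w ≠ c}ᶜ)
      (by simp only [zero_smul, add_zero]; exact mem_interior_iff_mem_nhds.mp hw)
    filter_upwards [this] with t ht
    exact not_not.mp ht
  have := AnalyticOnNhd.eq_of_eventuallyEq (fun x _ => hk.analyticAt x)
    (fun x _ => analyticAt_const) hev
  simpa [k] using congrFun this 1

/-- There is a line through the origin on which no nonconstant function of a finite family is
constant. -/
theorem exists_direction {m : ℕ} {κ : Type*} [Finite κ] {h : κ → Cn m → ℂ}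
    (hh : ∀ k, Differentiable ℂ (h k)) :
    ∃ w : Cn m, ∀ k, (∃ z, h k z ≠ h k 0) → h k w ≠ h k 0 := by
  let κ' := {k // ∃ z, h k z ≠ h k 0}
  have : Dense (⋂ k : κ', {w | h k w ≠ h k 0}) := by
    apply dense_iInter_of_isOpen
    · intro k
      exact isOpen_ne_fun (hh k).continuous continuous_const
    · intro k
      exact dense_setOf_ne_of_differentiable (hh k) _ k.2
  obtain ⟨w, hw⟩ := this.nonempty
  exact ⟨w, fun k hk => mem_iInter.mp hw ⟨k, hk⟩⟩

/-- The ratios `ψ` can be ordered by real numbers such that equal numbers belong to proportional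
functions and in any `n + N + 2` of the functions, some product of `N + 1` of them is
exchanged for another one. -/
theorem exists_exchange_valuation {m n N q : ℕ} {a : Fin q → Fin (n + 1) → ℂ}
    {b : Fin q → Fin (N + 1) → ℂ} (ha : InGeneralPosition a) (hb : InGeneralPosition b)
    {ψ : Fin q → Cn m → ℂ} (hψ : ∀ j, Differentiable ℂ (ψ j)) (hψ0 : ∀ j z, ψ j z ≠ 0)
    (hdet : ∀ r : Fin (n + 1) ⊕ Fin (N + 1) → Fin q, ∀ z,
      Matrix.det (Matrix.of fun i => leftRow (a (r i)) + ψ (r i) z • rightRow (b (r i))) = 0) :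
    ∃ x : Fin q → ℝ, (∀ i j, x i = x j → ∃ γ : ℂ, γ ≠ 0 ∧ ∀ z, ψ i z = γ * ψ j z) ∧
      ∀ r : Fin (n + 1) ⊕ Fin (N + 1) → Fin q, Function.Injective r →
        ∃ s : Finset (Fin (n + 1) ⊕ Fin (N + 1)), s.card = N + 1 ∧
          s ≠ Finset.univ.map Function.Embedding.inr ∧
          ∑ i ∈ s, x (r i) = ∑ i : Fin (N + 1), x (r (Sum.inr i)) := by
  classical
  obtain ⟨w, hw⟩ := exists_direction (κ := Fin q × Fin q) (h := fun k z => ψ k.1 z * (ψ k.2 z)⁻¹)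
    (fun k => (hψ k.1).fun_mul ((hψ k.2).fun_inv (hψ0 k.2)))
  have hlog : ∀ j, ∃ p : ℂ → ℂ, Differentiable ℂ p ∧ p 0 = 0 ∧
      ∀ t : ℂ, ψ j (t • w) = ψ j 0 * Complex.exp (p t) := by
    intro j
    obtain ⟨p, h1, h2, h3⟩ := exists_log (h := fun t : ℂ => ψ j (t • w))
      ((hψ j).comp (by fun_prop)) (fun t => hψ0 j _)
    exact ⟨p, h1, h2, fun t => by simpa using h3 t⟩
  choose p hp hp0 hψp using hlog
  let κ := {k : Fin q × Fin q // p k.1 - p k.2 ≠ 0}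
  -- A real linear functional that is nonzero on finitely many nonzero differences: it orders the
  -- exponents without identifying distinct ones.
  obtain ⟨ℓ, hℓ⟩ := Module.exists_dual_forall_apply_ne_zero (K := ℝ) (M := ℂ → ℂ)
    (fun k : κ => p k.1.1 - p k.1.2) (fun k => k.2)
  refine ⟨fun j => ℓ (p j), fun i j hij => ?_, fun r hr => ?_⟩
  · have hpij : p i = p j := by
      by_contra hne
      apply hℓ ⟨(i, j), sub_ne_zero.mpr hne⟩
      simp only [map_sub]
      exact sub_eq_zero.mpr hij
    refine ⟨ψ i 0 * (ψ j 0)⁻¹, mul_ne_zero (hψ0 _ _) (inv_ne_zero (hψ0 _ _)), fun z => ?_⟩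
    -- Equal exponents give the quotient equal values at `w` and `0`, so by the choice of `w` it is
    -- constant.
    have hconst : ψ i z * (ψ j z)⁻¹ = ψ i 0 * (ψ j 0)⁻¹ := by
      by_contra hne
      apply hw (i, j) ⟨z, hne⟩
      have h1 := hψp i 1
      have h2 := hψp j 1
      rw [one_smul] at h1 h2
      have := hψ0 j 0
      have := Complex.exp_ne_zero (p j 1)
      simp only [h1, h2, hpij]
      field_simp
    rw [← hconst]
    have := hψ0 j z
    field_simp
  · let ι := Fin (n + 1) ⊕ Fin (N + 1)
    let c : Finset ι → ℂ := mixedDet (fun i => a (r i)) (fun i => b (r i))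
    let S : Finset (Finset ι) := Finset.univ.filter fun s => c s ≠ 0
    let s₀ : Finset ι := Finset.univ.map Function.Embedding.inr
    have hs₀ : s₀.card = N + 1 := by simp [s₀]
    have hs₀S : s₀ ∈ S := Finset.mem_filter.mpr ⟨Finset.mem_univ _, mixedDet_ne_zero ha hb hr hs₀⟩
    let P : Finset ι → ℂ → ℂ := fun s => ∑ i ∈ s, p (r i)
    obtain ⟨s, hsS, hss₀, hs⟩ := borel_lemma P
      (fun s => Differentiable.sum fun i _ => hp (r i)) S
      (fun s => (∏ i ∈ s, ψ (r i) 0) * c s)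
      (fun s hs => mul_ne_zero (Finset.prod_ne_zero_iff.mpr fun i _ => hψ0 _ _)
        (Finset.mem_filter.mp hs).2)
      (fun t => by
        have h1 := hdet r (t • w)
        rw [det_leftRow_add_smul_rightRow (fun i => a (r i)) (fun i => b (r i))] at h1
        rw [← h1, Finset.sum_filter_of_ne (s := Finset.univ) (p := fun s => c s ≠ 0)
          (f := fun s => (∏ i ∈ s, ψ (r i) 0) * c s * Complex.exp (P s t))]
        · refine Finset.sum_congr rfl fun s _ => ?_
          simp only [P, hψp, Finset.prod_mul_distrib, Finset.sum_apply, Complex.exp_sum]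
          ring
        · intro s _ hs hc
          exact hs (by rw [hc]; ring)) s₀ hs₀S
    refine ⟨s, card_eq_of_mixedDet_ne_zero (Finset.mem_filter.mp hsS).2, hss₀, ?_⟩
    -- The constant in Borel's lemma is zero because all logarithms are normalised by `p j 0 = 0`.
    have hP : P s = P s₀ := by
      funext t
      have h1 := hs t 0
      have h2 : ∀ s, P s 0 = 0 := fun s => by simp [P, hp0]
      rw [h2, h2, sub_zero] at h1
      exact sub_eq_zero.mp h1
    have := congrArg ℓ hP
    simp only [P, map_sum] at this
    rw [this, Finset.sum_map]
    rfl

/-! ### Hyperplanes and linear relations among the forms -/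

theorem hyperplane_mk_iff {n : ℕ} (a v : Fin (n + 1) → ℂ) (hv : v ≠ 0) :
    Projectivization.mk ℂ v hv ∈ hyperplane a ↔ a ⬝ᵥ v = 0 := by
  obtain ⟨c, hc⟩ := Projectivization.exists_smul_eq_mk_rep ℂ v hv
  change a ⬝ᵥ (Projectivization.mk ℂ v hv).rep = 0 ↔ _
  rw [← hc]
  change a ⬝ᵥ ((c : ℂ) • v) = 0 ↔ _
  rw [dotProduct_smul, smul_eq_mul, mul_eq_zero]
  simp

theorem projMap_image_hyperplane {N n : ℕ} (T : (Fin (N + 1) → ℂ) ≃ₗ[ℂ] (Fin (n + 1) → ℂ))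
    {a : Fin (n + 1) → ℂ} {b : Fin (N + 1) → ℂ} {γ : ℂ} (hγ : γ ≠ 0)
    (h : ∀ y, a ⬝ᵥ T y = γ * (b ⬝ᵥ y)) : projMap T '' hyperplane b = hyperplane a := by
  have key : ∀ p : CP N, projMap T p ∈ hyperplane a ↔ p ∈ hyperplane b := by
    intro p
    induction p using Projectivization.ind with | h v hv =>
    rw [projMap, Projectivization.map_mk, hyperplane_mk_iff, hyperplane_mk_iff]
    change a ⬝ᵥ T v = 0 ↔ _
    rw [h, mul_eq_zero]
    simp [hγ]
  ext p
  constructor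
  · rintro ⟨p', hp', rfl⟩
    exact (key p').mpr hp'
  · intro hp
    induction p using Projectivization.ind with | h v hv =>
    have hv' : T.symm v ≠ 0 := by simpa using hv
    have e : projMap T (Projectivization.mk ℂ (T.symm v) hv') = Projectivization.mk ℂ v hv := by
      rw [projMap, Projectivization.map_mk]
      congr 1
      exact T.apply_symm_apply v
    exact ⟨_, (key _).mp (by rwa [e]), e⟩

/-- A zero coefficient would leave a relation among `n + 1` forms, hence only the trivial one. -/
theorem InGeneralPosition.exists_relation {n q : ℕ} {a : Fin q → Fin (n + 1) → ℂ}
    (ha : InGeneralPosition a) {S : Finset (Fin q)} (hS : S.card = n + 2) :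
    ∃ c : Fin q → ℂ, (∀ j ∈ S, c j ≠ 0) ∧ (∀ j ∉ S, c j = 0) ∧ ∑ j, c j • a j = 0 := by
  classical
  have hnot : ¬ LinearIndependent ℂ (fun j : S => a j) := by
    intro h
    have := h.fintype_card_le_finrank
    simp [hS] at this
  rw [Fintype.not_linearIndependent_iff] at hnot
  obtain ⟨d, hd, i₀, hi₀⟩ := hnot
  let c : Fin q → ℂ := fun j => if h : j ∈ S then d ⟨j, h⟩ else 0
  have hcd : ∀ j : S, c j = d j := fun j => by simp [c]
  have hcS : ∑ j ∈ S, c j • a j = 0 := by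
    rw [← hd, ← Finset.sum_coe_sort]
    exact Finset.sum_congr rfl fun j _ => by rw [hcd]
  have hc0 : ∀ j ∉ S, c j = 0 := fun j hj => by simp [c, hj]
  refine ⟨c, fun j hj hcj => ?_, hc0, ?_⟩
  · have h0 := ha.eq_zero_of_sum_eq_zero Function.injective_id (s := S.erase j) (x := c)
      (by rw [Finset.card_erase_of_mem hj, hS]; rfl)
      (by rw [← hcS, ← Finset.add_sum_erase S _ hj, hcj]; simp)
    apply hi₀
    rw [← hcd]
    by_cases h : (i₀ : Fin q) = j
    · rw [h, hcj]
    · exact h0 _ (Finset.mem_erase.mpr ⟨h, i₀.2⟩)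
  · rw [← hcS]
    refine (Finset.sum_subset (Finset.subset_univ S) fun j _ hj => ?_).symm
    rw [hc0 j hj, zero_smul]

theorem InGeneralPosition.exists_dotProduct_eq {N q : ℕ} {b : Fin q → Fin (N + 1) → ℂ}
    (hb : InGeneralPosition b) {S : Finset (Fin q)} (hS : S.card ≤ N + 1) (t : Fin q → ℂ) :
    ∃ y, ∀ j ∈ S, b j ⬝ᵥ y = t j := by
  let M : Matrix S (Fin (N + 1)) ℂ := Matrix.of fun j => b j
  have hM : LinearIndependent ℂ M.row := hb S hS
  have hsurj : Function.Surjective M.mulVecLin := by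
    rw [← LinearMap.range_eq_top]
    apply Submodule.eq_top_of_finrank_eq
    rw [Module.finrank_fintype_fun_eq_card]
    exact hM.rank_matrix
  obtain ⟨y, hy⟩ := hsurj fun j => t j
  exact ⟨y, fun j hj => congrFun hy ⟨j, hj⟩⟩

/-- A linear relation between the forms `a` whose indices belong to proportional functions `ψ`
yields a linear relation between the forms `b`. -/
theorem sum_smul_eq_zero_of_proportional {n N q : ℕ} {X : Type*} {a : Fin q → Fin (n + 1) → ℂ}
    {b : Fin q → Fin (N + 1) → ℂ} {ψ : Fin q → X → ℂ} {Y : X → Fin (N + 1) → ℂ}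
    (hψ0 : ∀ j z, ψ j z ≠ 0)
    (hrel : ∀ c : Fin q → ℂ, ∑ j, c j • a j = 0 → ∀ z, ∑ j, c j * ψ j z * (b j ⬝ᵥ Y z) = 0)
    (hlin : ∀ v, (∀ z, v ⬝ᵥ Y z = 0) → v = 0) {S : Finset (Fin q)} {k : Fin q} {γ : Fin q → ℂ}
    (hγ : ∀ j ∈ S, ∀ z, ψ j z = γ j * ψ k z) {c : Fin q → ℂ} (hcS : ∀ j ∉ S, c j = 0)
    (hc : ∑ j, c j • a j = 0) : ∑ j ∈ S, (c j * γ j) • b j = 0 := by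
  apply hlin
  intro z
  have h := hrel c hc z
  rw [← Finset.sum_subset (Finset.subset_univ S) fun j _ hj => by rw [hcS j hj]; ring] at h
  rw [sum_dotProduct]
  apply mul_left_cancel₀ (hψ0 k z)
  rw [mul_zero, ← h, Finset.mul_sum]
  refine Finset.sum_congr rfl fun j hj => ?_
  rw [hγ j hj, smul_dotProduct, smul_eq_mul]
  ring

/-- For `n < N` the transferred relation involves `n + 2 ≤ N + 1` forms `b j`, which are
independent, yet its coefficients are nonzero. -/
theorem not_proportional_of_lt {n N q : ℕ} {X : Type*} {a : Fin q → Fin (n + 1) → ℂ}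
    {b : Fin q → Fin (N + 1) → ℂ} (ha : InGeneralPosition a) (hb : InGeneralPosition b)
    (hnN : n < N) {ψ : Fin q → X → ℂ} {Y : X → Fin (N + 1) → ℂ} (hψ0 : ∀ j z, ψ j z ≠ 0)
    (hrel : ∀ c : Fin q → ℂ, ∑ j, c j • a j = 0 → ∀ z, ∑ j, c j * ψ j z * (b j ⬝ᵥ Y z) = 0)
    (hlin : ∀ v, (∀ z, v ⬝ᵥ Y z = 0) → v = 0) {S : Finset (Fin q)} (hS : S.card = n + 2)
    {k : Fin q} {γ : Fin q → ℂ} (hγ0 : ∀ j ∈ S, γ j ≠ 0)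
    (hγ : ∀ j ∈ S, ∀ z, ψ j z = γ j * ψ k z) : False := by
  obtain ⟨c, hc0, hcS, hc⟩ := ha.exists_relation hS
  have h1 := hb.eq_zero_of_sum_eq_zero Function.injective_id (by omega)
    (sum_smul_eq_zero_of_proportional hψ0 hrel hlin hγ hcS hc)
  obtain ⟨j, hj⟩ := Finset.card_pos.mp (by omega : 0 < S.card)
  exact mul_ne_zero (hc0 j hj) (hγ0 j hj) (h1 j hj)

/-- Relations `c` omitting `i₀ ∈ S₁` and `d` omitting `e₀ ∈ S₂` give `ψ₁ C₁ + ψ₂ C₂ = 0` and `ψ₁ D₁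
+ ψ₂ D₂ = 0` along `g`, with `ψ₁ = ψ k₁`, `ψ₂ = ψ k₂` and linear forms `C`, `D`. Hence `C₁ D₂ - D₁
C₂` vanishes along `g`, so identically; but some point has `C₂ = 0` and `C₁`, `D₂` nonzero. -/
theorem not_two_proportional_classes {n N q : ℕ} {X : Type*} {a : Fin q → Fin (n + 1) → ℂ}
    {b : Fin q → Fin (N + 1) → ℂ} (ha : InGeneralPosition a) (hb : InGeneralPosition b)
    (hnN : n < N) {ψ : Fin q → X → ℂ} {Y : X → Fin (N + 1) → ℂ} (hψ0 : ∀ j z, ψ j z ≠ 0)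
    (hrel : ∀ c : Fin q → ℂ, ∑ j, c j • a j = 0 → ∀ z, ∑ j, c j * ψ j z * (b j ⬝ᵥ Y z) = 0)
    (hquad : ∀ v₁ v₂ v₃ v₄, (∀ z, (v₁ ⬝ᵥ Y z) * (v₂ ⬝ᵥ Y z) - (v₃ ⬝ᵥ Y z) * (v₄ ⬝ᵥ Y z) = 0) →
      ∀ y, (v₁ ⬝ᵥ y) * (v₂ ⬝ᵥ y) - (v₃ ⬝ᵥ y) * (v₄ ⬝ᵥ y) = 0)
    {S₁ S₂ : Finset (Fin q)} (hdisj : Disjoint S₁ S₂) (hcard : S₁.card + S₂.card = n + 3)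
    (h₁ : 2 ≤ S₁.card) (h₂ : 2 ≤ S₂.card) {k₁ k₂ : Fin q} {γ : Fin q → ℂ}
    (hγ0 : ∀ j ∈ S₁ ∪ S₂, γ j ≠ 0)
    (hγ₁ : ∀ j ∈ S₁, ∀ z, ψ j z = γ j * ψ k₁ z) (hγ₂ : ∀ j ∈ S₂, ∀ z, ψ j z = γ j * ψ k₂ z) :
    False := by
  classical
  obtain ⟨i₀, hi₀, i₁, hi₁, hi⟩ := Finset.one_lt_card.mp (by omega : 1 < S₁.card)
  obtain ⟨e₀, he₀, e₁, he₁, he⟩ := Finset.one_lt_card.mp (by omega : 1 < S₂.card)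
  have hd : ∀ {i j}, i ∈ S₁ → j ∈ S₂ → i ≠ j := fun hi hj h =>
    Finset.disjoint_left.mp hdisj hi (h ▸ hj)
  have hSc : (S₁ ∪ S₂).card = n + 3 := by rw [Finset.card_union_of_disjoint hdisj, hcard]
  have hi₀u : i₀ ∈ S₁ ∪ S₂ := Finset.mem_union_left _ hi₀
  have hi₁u : i₁ ∈ S₁ ∪ S₂ := Finset.mem_union_left _ hi₁
  have he₀u : e₀ ∈ S₁ ∪ S₂ := Finset.mem_union_right _ he₀
  have he₁u : e₁ ∈ S₁ ∪ S₂ := Finset.mem_union_right _ he₁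
  have hca : ((S₁ ∪ S₂).erase i₀).card = n + 2 := by rw [Finset.card_erase_of_mem hi₀u, hSc]; rfl
  have hcb : ((S₁ ∪ S₂).erase e₀).card = n + 2 := by rw [Finset.card_erase_of_mem he₀u, hSc]; rfl
  obtain ⟨c, hc0, hcS, hc⟩ := ha.exists_relation hca
  obtain ⟨d, hd0, hdS, hd'⟩ := ha.exists_relation hcb
  let form : (Fin q → ℂ) → Finset (Fin q) → Fin (N + 1) → ℂ := fun c S => ∑ j ∈ S, (c j * γ j) • b j
  have hform : ∀ c S y, form c S ⬝ᵥ y = ∑ j ∈ S, c j * γ j * (b j ⬝ᵥ y) := by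
    intro c S y
    simp only [form, sum_dotProduct, smul_dotProduct, smul_eq_mul]
  have hsplit : ∀ c : Fin q → ℂ, (∀ j ∉ S₁ ∪ S₂, c j = 0) → ∑ j, c j • a j = 0 → ∀ z,
      ψ k₁ z * (form c S₁ ⬝ᵥ Y z) + ψ k₂ z * (form c S₂ ⬝ᵥ Y z) = 0 := by
    intro c hcS hc z
    have h := hrel c hc z
    rw [← Finset.sum_subset (Finset.subset_univ (S₁ ∪ S₂)) fun j _ hj => by rw [hcS j hj]; ring,
      Finset.sum_union hdisj] at h
    rw [← h, hform, hform, Finset.mul_sum, Finset.mul_sum]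
    congr 1 <;> refine Finset.sum_congr rfl fun j hj => ?_
    · rw [hγ₁ j hj]; ring
    · rw [hγ₂ j hj]; ring
  have hc1 := hsplit c (fun j hj => hcS j fun h => hj (Finset.mem_of_mem_erase h)) hc
  have hc2 := hsplit d (fun j hj => hdS j fun h => hj (Finset.mem_of_mem_erase h)) hd'
  have hall := hquad (form c S₁) (form d S₂) (form d S₁) (form c S₂) fun z => by
    apply mul_left_cancel₀ (hψ0 k₁ z)
    linear_combination (form d S₂ ⬝ᵥ Y z) * hc1 z - (form c S₂ ⬝ᵥ Y z) * hc2 z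
  -- The values at `e₀` and `e₁` cancel in `C₂` but not in `D₂`, which lacks `e₀`; the value at `i₁`
  -- keeps `C₁` nonzero. The form at `i₀` is left free: it occurs only in `D₁`, which is multiplied
  -- by `C₂ = 0`.
  let t : Fin q → ℂ := fun j => if j = i₁ then 1 else if j = e₁ then c e₀ * γ e₀ else
    if j = e₀ then - (c e₁ * γ e₁) else 0
  obtain ⟨y, hy⟩ := hb.exists_dotProduct_eq (S := (S₁ ∪ S₂).erase i₀) (by omega) t
  have hy' : ∀ j ∈ S₁ ∪ S₂, j ≠ i₀ → b j ⬝ᵥ y = t j := fun j hj hji =>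
    hy j (Finset.mem_erase.mpr ⟨hji, hj⟩)
  have hci₀ : c i₀ = 0 := hcS i₀ (by simp)
  have hde₀ : d e₀ = 0 := hdS e₀ (by simp)
  have hi₁t : t i₁ = 1 := by simp [t]
  have he₁t : t e₁ = c e₀ * γ e₀ := by simp [t, (hd hi₁ he₁).symm]
  have he₀t : t e₀ = - (c e₁ * γ e₁) := by simp [t, (hd hi₁ he₀).symm, he]
  have v1 : form c S₁ ⬝ᵥ y = c i₁ * γ i₁ := by
    rw [hform, Finset.sum_eq_single_of_mem i₁ hi₁]
    · rw [hy' i₁ hi₁u (Ne.symm hi), hi₁t, mul_one]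
    · intro j hj hji
      by_cases hj0 : j = i₀
      · rw [hj0, hci₀]; ring
      · rw [hy' j (Finset.mem_union_left _ hj) hj0]
        simp [t, hji, hd hj he₁, hd hj he₀]
  have hyS₂ : ∀ j ∈ S₂, b j ⬝ᵥ y = t j := fun j hj =>
    hy' j (Finset.mem_union_right _ hj) (hd hi₀ hj).symm
  have hS₂t : ∀ j ∈ S₂, j ≠ e₀ → j ≠ e₁ → t j = 0 := fun j hj h0 h1 => by
    simp [t, (hd hi₁ hj).symm, h0, h1]
  have v4 : form c S₂ ⬝ᵥ y = 0 := by
    rw [hform, Finset.sum_eq_add_of_mem e₀ e₁ he₀ he₁ he, hyS₂ _ he₀, hyS₂ _ he₁, he₀t, he₁t]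
    · ring
    · rintro j hj ⟨h0, h1⟩
      rw [hyS₂ j hj, hS₂t j hj h0 h1, mul_zero]
  have v2 : form d S₂ ⬝ᵥ y = d e₁ * γ e₁ * (c e₀ * γ e₀) := by
    rw [hform, Finset.sum_eq_single_of_mem e₁ he₁, hyS₂ _ he₁, he₁t]
    intro j hj h1
    by_cases h0 : j = e₀
    · rw [h0, hde₀]; ring
    · rw [hyS₂ j hj, hS₂t j hj h0 h1, mul_zero]
  have := hall y
  rw [v1, v2, v4, mul_zero, sub_zero] at this
  have n1 := hc0 i₁ (Finset.mem_erase.mpr ⟨Ne.symm hi, hi₁u⟩)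
  have n2 := hd0 e₁ (Finset.mem_erase.mpr ⟨Ne.symm he, he₁u⟩)
  have n3 := hc0 e₀ (Finset.mem_erase.mpr ⟨(hd hi₀ he₀).symm, he₀u⟩)
  exact mul_ne_zero (mul_ne_zero n1 (hγ0 _ hi₁u))
    (mul_ne_zero (mul_ne_zero n2 (hγ0 _ he₁u)) (mul_ne_zero n3 (hγ0 _ he₀u))) this

/-! ### Nondegeneracy -/

theorem MeroMap.NotInHypersurfaceOfDegreeLE.eq_zero {m N d k : ℕ} {g : MeroMap m N}
    (hg : g.NotInHypersurfaceOfDegreeLE d) (hk : 1 ≤ k) (hkd : k ≤ d)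
    {P : MvPolynomial (Fin (N + 1)) ℂ} (hP : P.IsHomogeneous k)
    (h : ∀ z, MvPolynomial.eval (g.vec z) P = 0) : P = 0 := by
  by_contra hP0
  refine hg k P hk hkd hP hP0 ?_
  rintro _ ⟨z, hz, rfl⟩
  have := h z
  rwa [MeroMap.vec, dif_pos hz] at this

/-- The linear form with coefficients `v` as a polynomial. -/
noncomputable def linearPoly {N : ℕ} (v : Fin (N + 1) → ℂ) : MvPolynomial (Fin (N + 1)) ℂ :=
  ∑ i, MvPolynomial.C (v i) * MvPolynomial.X i

theorem eval_linearPoly {N : ℕ} (v y : Fin (N + 1) → ℂ) :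
    MvPolynomial.eval y (linearPoly v) = v ⬝ᵥ y := by
  simp [linearPoly, dotProduct]

theorem isHomogeneous_linearPoly {N : ℕ} (v : Fin (N + 1) → ℂ) : (linearPoly v).IsHomogeneous 1 :=
  MvPolynomial.IsHomogeneous.sum _ _ _ fun i _ => by
    simpa using (MvPolynomial.isHomogeneous_C (Fin (N + 1)) (v i)).mul (MvPolynomial.isHomogeneous_X ℂ i)

theorem MeroMap.NotInHypersurfaceOfDegreeLE.linear {m N : ℕ} {g : MeroMap m N}
    (hg : g.NotInHypersurfaceOfDegreeLE 2) {v : Fin (N + 1) → ℂ} (h : ∀ z, v ⬝ᵥ g.vec z = 0) :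
    v = 0 := by
  have := hg.eq_zero le_rfl (by norm_num) (isHomogeneous_linearPoly v)
    fun z => by rw [eval_linearPoly, h]
  funext i
  have h1 := eval_linearPoly v (Pi.single i 1)
  rw [this] at h1
  simpa using h1.symm

theorem MeroMap.NotInHypersurfaceOfDegreeLE.quadratic {m N : ℕ} {g : MeroMap m N}
    (hg : g.NotInHypersurfaceOfDegreeLE 2) (v₁ v₂ v₃ v₄ : Fin (N + 1) → ℂ)
    (h : ∀ z, (v₁ ⬝ᵥ g.vec z) * (v₂ ⬝ᵥ g.vec z) - (v₃ ⬝ᵥ g.vec z) * (v₄ ⬝ᵥ g.vec z) = 0)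
    (y : Fin (N + 1) → ℂ) : (v₁ ⬝ᵥ y) * (v₂ ⬝ᵥ y) - (v₃ ⬝ᵥ y) * (v₄ ⬝ᵥ y) = 0 := by
  have hP : (linearPoly v₁ * linearPoly v₂ - linearPoly v₃ * linearPoly v₄).IsHomogeneous 2 :=
    ((isHomogeneous_linearPoly v₁).mul (isHomogeneous_linearPoly v₂)).sub
      ((isHomogeneous_linearPoly v₃).mul (isHomogeneous_linearPoly v₄))
  have := hg.eq_zero (by norm_num) le_rfl hP fun z => by
    simpa [eval_linearPoly] using h z
  simpa [eval_linearPoly] using congrArg (MvPolynomial.eval y) this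

/-! ### Proportional functions in sorted order -/

/-- If every value on the right were smaller than every value on the left, exchanging any right
indices for as many left ones would strictly increase the sum. -/
theorem le_of_sum_exchange {α β : Type*} [Fintype β] {x : α ⊕ β → ℝ} {s : Finset (α ⊕ β)}
    (hcard : s.card = Fintype.card β) (hs : s ≠ Finset.univ.map Function.Embedding.inr)
    (hsum : ∑ i ∈ s, x i = ∑ i : β, x (Sum.inr i)) {c d : ℝ} (hc : ∀ i, x (Sum.inr i) ≤ c)
    (hd : ∀ i, d ≤ x (Sum.inl i)) : d ≤ c := by
  classical
  by_contra! hlt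
  set s₀ : Finset (α ⊕ β) := Finset.univ.map Function.Embedding.inr with hs₀
  have hs₀c : s.card = s₀.card := by rw [hcard, hs₀, Finset.card_map, Finset.card_univ]
  have hsum' : ∑ i ∈ s, x i = ∑ i ∈ s₀, x i := by rw [hsum, hs₀, Finset.sum_map]; rfl
  have hcd : (s \ s₀).card = (s₀ \ s).card := Finset.card_sdiff_comm hs₀c
  have hsd : ∑ i ∈ s \ s₀, x i = ∑ i ∈ s₀ \ s, x i := by
    have h1 := Finset.sum_inter_add_sum_sdiff s s₀ x
    have h2 := Finset.sum_inter_add_sum_sdiff s₀ s x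
    rw [Finset.inter_comm] at h2
    linarith
  have hpos : 0 < (s \ s₀).card := by
    rw [Finset.card_pos, Finset.sdiff_nonempty]
    exact fun h => hs (Finset.eq_of_subset_of_card_le h hs₀c.ge)
  have h1 : (s \ s₀).card • d ≤ ∑ i ∈ s \ s₀, x i := by
    apply Finset.card_nsmul_le_sum
    rintro (i | i) hi
    · exact hd i
    · exact absurd (Finset.mem_map_of_mem _ (Finset.mem_univ i)) (Finset.mem_sdiff.mp hi).2
  have h2 : ∑ i ∈ s₀ \ s, x i ≤ (s₀ \ s).card • c := by
    apply Finset.sum_le_card_nsmul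
    intro i hi
    obtain ⟨k, -, rfl⟩ := Finset.mem_map.mp (Finset.mem_sdiff.mp hi).1
    exact hc k
  rw [hsd] at h1
  rw [← hcd] at h2
  have h3 := h1.trans h2
  rw [nsmul_eq_mul, nsmul_eq_mul] at h3
  have : (0 : ℝ) < (s \ s₀).card := by exact_mod_cast hpos
  nlinarith

/-- With positions counted from `0`, the two inequalities make `x ∘ σ` constant on positions `N, …,
q - n - 1` and on `n, …, q - N - 1` when these ranges are nonempty. They come from giving the
`b`-rows the `N + 1` smallest, respectively largest, values and the `a`-rows the `n + 1` at the
other end. -/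
theorem exists_sorted_classes {n N q : ℕ} (hq : n + N + 2 ≤ q) {x : Fin q → ℝ}
    (hx : ∀ r : Fin (n + 1) ⊕ Fin (N + 1) → Fin q, Function.Injective r →
        ∃ s : Finset (Fin (n + 1) ⊕ Fin (N + 1)), s.card = N + 1 ∧
          s ≠ Finset.univ.map Function.Embedding.inr ∧
          ∑ i ∈ s, x (r i) = ∑ i : Fin (N + 1), x (r (Sum.inr i))) :
    ∃ σ : ℕ → Fin q, InjOn σ (Iio q) ∧ (∀ i j, i ≤ j → j < q → x (σ i) ≤ x (σ j)) ∧
      x (σ (q - n - 1)) ≤ x (σ N) ∧ x (σ (q - N - 1)) ≤ x (σ n) := by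
  have hq0 : 0 < q := by omega
  let σ : ℕ → Fin q := fun i => if h : i < q then Tuple.sort x ⟨i, h⟩ else ⟨0, hq0⟩
  have hσ : ∀ i (h : i < q), σ i = Tuple.sort x ⟨i, h⟩ := fun i h => by simp [σ, h]
  have hinj : InjOn σ (Iio q) := by
    intro i hi j hj hij
    rw [hσ i hi, hσ j hj] at hij
    exact Fin.mk.inj ((Tuple.sort x).injective hij)
  have hmono : ∀ i j, i ≤ j → j < q → x (σ i) ≤ x (σ j) := by
    intro i j hij hj
    rw [hσ i (lt_of_le_of_lt hij hj), hσ j hj]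
    exact Tuple.monotone_sort x (by simpa using hij)
  refine ⟨σ, hinj, hmono, ?_, ?_⟩
  · let r : Fin (n + 1) ⊕ Fin (N + 1) → Fin q :=
      Sum.elim (fun k => σ (q - n - 1 + k)) (fun i => σ i)
    have hr : Function.Injective r := by
      rintro (i | i) (j | j) h
      all_goals
        have h' := hinj (by simp only [mem_Iio]; omega) (by simp only [mem_Iio]; omega) h
      · congr 1; ext; omega
      · omega
      · omega
      · congr 1; ext; omega
    obtain ⟨s, h1, h2, h3⟩ := hx r hr
    refine le_of_sum_exchange (x := fun i => x (r i)) (by simpa using h1) h2 h3 (fun i => ?_)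
      (fun k => ?_)
    · exact hmono _ _ (by omega) (by omega)
    · exact hmono _ _ (by omega) (by omega)
  · let r : Fin (n + 1) ⊕ Fin (N + 1) → Fin q :=
      Sum.elim (fun k => σ k) (fun i => σ (q - N - 1 + i))
    have hr : Function.Injective r := by
      rintro (i | i) (j | j) h
      all_goals
        have h' := hinj (by simp only [mem_Iio]; omega) (by simp only [mem_Iio]; omega) h
      · congr 1; ext; omega
      · omega
      · omega
      · congr 1; ext; omega
    obtain ⟨s, h1, h2, h3⟩ := hx r hr
    have := le_of_sum_exchange (x := fun i => - x (r i)) (by simpa using h1) h2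
      (by simpa using h3) (c := - x (σ (q - N - 1))) (d := - x (σ n)) (fun i => ?_) (fun k => ?_)
    · linarith
    · exact neg_le_neg (hmono _ _ (by omega) (by omega))
    · exact neg_le_neg (hmono _ _ (by omega) (by omega))

theorem exists_class_of_sorted {q : ℕ} {x : Fin q → ℝ} {σ : ℕ → Fin q} (hσ : InjOn σ (Iio q))
    (hmono : ∀ i j, i ≤ j → j < q → x (σ i) ≤ x (σ j)) {l h k : ℕ} (hh : h < q)
    (hle : x (σ h) ≤ x (σ l)) (hk : l + k ≤ h + 1) :
    ∃ S : Finset (Fin q), S.card = k ∧ ∀ j ∈ S, x j = x (σ l) := by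
  refine ⟨(Finset.Ico l (l + k)).image σ, ?_, fun j hj => ?_⟩
  · rw [Finset.card_image_of_injOn, Nat.card_Ico, Nat.add_sub_cancel_left]
    refine hσ.mono fun i hi => ?_
    simp only [Finset.coe_Ico, mem_Ico] at hi
    simp only [mem_Iio]; omega
  · obtain ⟨i, hi, rfl⟩ := Finset.mem_image.mp hj
    rw [Finset.mem_Ico] at hi
    exact le_antisymm ((hmono i h (by omega) hh).trans hle) (hmono l i hi.1 (by omega))

/-- A sufficiently large class of proportional functions determines a projective linear map. -/
theorem exists_linearEquiv_of_class {n q : ℕ} {X : Type*} {a b : Fin q → Fin (n + 1) → ℂ}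
    (ha : InGeneralPosition a) (hb : InGeneralPosition b)
    {ψ : Fin q → X → ℂ} {Y : X → Fin (n + 1) → ℂ} (hψ0 : ∀ j z, ψ j z ≠ 0)
    (hrel : ∀ c : Fin q → ℂ, ∑ j, c j • a j = 0 → ∀ z, ∑ j, c j * ψ j z * (b j ⬝ᵥ Y z) = 0)
    (hlin : ∀ v, (∀ z, v ⬝ᵥ Y z = 0) → v = 0) {S : Finset (Fin q)} (hS : S.card = n + 2)
    {k : Fin q} {γ : Fin q → ℂ} (hγ0 : ∀ j ∈ S, γ j ≠ 0)
    (hγ : ∀ j ∈ S, ∀ z, ψ j z = γ j * ψ k z) :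
    ∃ T : (Fin (n + 1) → ℂ) ≃ₗ[ℂ] (Fin (n + 1) → ℂ),
      (∀ j ∈ S, ∀ y, a j ⬝ᵥ T y = γ j * (b j ⬝ᵥ y)) ∧
      ∀ v w, (∀ j ∈ S, a j ⬝ᵥ v = a j ⬝ᵥ w) → v = w := by
  classical
  obtain ⟨c, hc0, hcS, hc⟩ := ha.exists_relation hS
  have hcb := sum_smul_eq_zero_of_proportional hψ0 hrel hlin hγ hcS hc
  obtain ⟨e, he⟩ := Finset.card_pos.mp (by omega : 0 < S.card)
  have hcard : (S.erase e).card = n + 1 := by rw [Finset.card_erase_of_mem he, hS]; rfl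
  let ε : Fin (n + 1) ≃ S.erase e := (Finset.equivFinOfCardEq hcard).symm
  have hεS : ∀ i, (ε i : Fin q) ∈ S := fun i => Finset.mem_of_mem_erase (ε i).2
  let A : Matrix (Fin (n + 1)) (Fin (n + 1)) ℂ := Matrix.of fun i => a (ε i)
  let B : Matrix (Fin (n + 1)) (Fin (n + 1)) ℂ := Matrix.of fun i => γ (ε i) • b (ε i)
  have hA : IsUnit A := by
    rw [← Matrix.linearIndependent_rows_iff_isUnit]
    exact (ha _ hcard.le).comp ε ε.injective
  have hB : IsUnit B := by
    rw [← Matrix.linearIndependent_rows_iff_isUnit]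
    have h1 := (hb _ hcard.le).comp ε ε.injective
    exact h1.units_smul fun i => Units.mk0 (γ (ε i)) (hγ0 _ (hεS i))
  let eA : (Fin (n + 1) → ℂ) ≃ₗ[ℂ] (Fin (n + 1) → ℂ) :=
    LinearEquiv.ofBijective A.mulVecLin
      ⟨Matrix.mulVec_injective_iff_isUnit.mpr hA, Matrix.mulVec_surjective_iff_isUnit.mpr hA⟩
  let eB : (Fin (n + 1) → ℂ) ≃ₗ[ℂ] (Fin (n + 1) → ℂ) :=
    LinearEquiv.ofBijective B.mulVecLin
      ⟨Matrix.mulVec_injective_iff_isUnit.mpr hB, Matrix.mulVec_surjective_iff_isUnit.mpr hB⟩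
  have hT : ∀ y, A *ᵥ (eA.symm (eB y)) = B *ᵥ y := fun y => eA.apply_symm_apply (eB y)
  have hT1 : ∀ j ∈ S.erase e, ∀ y, a j ⬝ᵥ eA.symm (eB y) = γ j * (b j ⬝ᵥ y) := by
    intro j hj y
    have h1 : a (ε (ε.symm ⟨j, hj⟩)) ⬝ᵥ eA.symm (eB y) =
        (γ (ε (ε.symm ⟨j, hj⟩)) • b (ε (ε.symm ⟨j, hj⟩))) ⬝ᵥ y :=
      congrFun (hT y) (ε.symm ⟨j, hj⟩)
    rwa [Equiv.apply_symm_apply, smul_dotProduct, smul_eq_mul] at h1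
  refine ⟨eB.trans eA.symm, fun j hj y => ?_, fun v w hvw => ?_⟩
  · change a j ⬝ᵥ eA.symm (eB y) = _
    -- `T` is built from `n + 1` of the forms; the last one follows from the parallel relations
    -- among the `a j` and the `γ j • b j`.
    by_cases hje : j = e
    · subst hje
      have h1 : ∑ i ∈ S, c i * (a i ⬝ᵥ eA.symm (eB y)) = 0 := by
        rw [← Finset.sum_subset (Finset.subset_univ S) fun i _ hi => by
          rw [hcS i hi, zero_smul]] at hc
        have := congrArg (· ⬝ᵥ eA.symm (eB y)) hc
        simpa [sum_dotProduct, smul_dotProduct] using this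
      have h2 : ∑ i ∈ S, c i * (γ i * (b i ⬝ᵥ y)) = 0 := by
        have := congrArg (· ⬝ᵥ y) hcb
        simpa [sum_dotProduct, smul_dotProduct, mul_assoc] using this
      rw [← Finset.add_sum_erase S _ hj] at h1 h2
      rw [Finset.sum_congr rfl fun i hi => by rw [hT1 i hi y]] at h1
      apply mul_left_cancel₀ (hc0 j hj)
      linear_combination h1 - h2
    · exact hT1 j (Finset.mem_erase.mpr ⟨hje, hj⟩) y
  · apply eA.injective
    funext i
    exact hvw _ (hεS i)

/-- The forms `a j`, `j ∈ S`, separate vectors and agree on `F` and `(u * ψ k) • T G`, so these are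
equal. The scalar being nonzero, the indeterminacy loci coincide too. -/
theorem eqComp_of_linearEquiv {m n N q : ℕ} {a : Fin q → Fin (n + 1) → ℂ}
    {b : Fin q → Fin (N + 1) → ℂ} {f : MeroMap m n} {g : MeroMap m N} {ψ : Fin q → Cn m → ℂ}
    (hψ0 : ∀ j z, ψ j z ≠ 0)
    (hloc : ∀ z, ∃ F G, IsReducedRepAt f.indet f.toFun z F ∧
      IsReducedRepAt g.indet g.toFun z G ∧ ∃ u : Cn m → ℂ, ∀ᶠ w in 𝓝 z,
        u w ≠ 0 ∧ ∀ j, a j ⬝ᵥ F w = u w * ψ j w * (b j ⬝ᵥ G w))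
    {S : Finset (Fin q)} {k : Fin q} {γ : Fin q → ℂ} (hγ : ∀ j ∈ S, ∀ z, ψ j z = γ j * ψ k z)
    (T : (Fin (N + 1) → ℂ) ≃ₗ[ℂ] (Fin (n + 1) → ℂ))
    (hT : ∀ j ∈ S, ∀ y, a j ⬝ᵥ T y = γ j * (b j ⬝ᵥ y))
    (hinj : ∀ v w, (∀ j ∈ S, a j ⬝ᵥ v = a j ⬝ᵥ w) → v = w) : f.EqComp (projMap T) g := by
  have key : ∀ z, ∃ F G, (z ∈ f.indet ↔ F = 0) ∧ (z ∈ g.indet ↔ G = 0) ∧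
      (∀ (h : z ∉ f.indet) (h0 : F ≠ 0), f.toFun z h = Projectivization.mk ℂ F h0) ∧
      (∀ (h : z ∉ g.indet) (h0 : G ≠ 0), g.toFun z h = Projectivization.mk ℂ G h0) ∧
      ∃ c : ℂ, c ≠ 0 ∧ F = c • T G := by
    intro z
    obtain ⟨F, G, hF, hG, u, hu⟩ := hloc z
    obtain ⟨hu0, hu⟩ := hu.self_of_nhds
    obtain ⟨hF1, hF2⟩ := hF.2.self_of_nhds
    obtain ⟨hG1, hG2⟩ := hG.2.self_of_nhds
    refine ⟨F z, G z, hF1, hG1, hF2, hG2, u z * ψ k z, mul_ne_zero hu0 (hψ0 _ _), ?_⟩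
    apply hinj
    intro j hj
    rw [hu j, dotProduct_smul, hT j hj, hγ j hj, smul_eq_mul]
    ring
  refine ⟨?_, fun z hf hg => ?_⟩
  · ext z
    obtain ⟨F, G, h1, h2, -, -, c, hc, hFG⟩ := key z
    rw [h1, h2, hFG]
    simp [hc]
  · obtain ⟨F, G, h1, h2, h3, h4, c, hc, hFG⟩ := key z
    have hF0 : F ≠ 0 := fun h => hf (h1.mpr h)
    have hG0 : G ≠ 0 := fun h => hg (h2.mpr h)
    rw [h3 hf hF0, h4 hg hG0, projMap, Projectivization.map_mk, Projectivization.mk_eq_mk_iff']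
    exact ⟨c, hFG.symm⟩

end UniquenessMero

/-! ### The main theorem -/

theorem mainTheorem6 (m n N q : ℕ) (hn : 1 ≤ n) (hnN : n ≤ N)
    (a : Fin q → Fin (n + 1) → ℂ) (b : Fin q → Fin (N + 1) → ℂ)
    (ha : UniquenessMero.InGeneralPosition a) (hb : UniquenessMero.InGeneralPosition b)
    (f : UniquenessMero.MeroMap m n) (g : UniquenessMero.MeroMap m N)
    (hf : ∀ j, ¬ f.image ⊆ UniquenessMero.hyperplane (a j))
    (hg : ∀ j, ¬ g.image ⊆ UniquenessMero.hyperplane (b j))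
    (hfg : ∀ j, f.pullbackDivisor (a j) = g.pullbackDivisor (b j))
    (hdeg : g.NotInHypersurfaceOfDegreeLE 2)
    (hq : max (3 * (n : ℝ) + 2) ((N : ℝ) + 3 / 2 * (n : ℝ) + 3 / 2) ≤ (q : ℝ)) :
    N = n ∧
      ∃ (T : (Fin (N + 1) → ℂ) ≃ₗ[ℂ] (Fin (n + 1) → ℂ)) (k : Fin (n + 2) → Fin q),
        Function.Injective k ∧
        f.EqComp (UniquenessMero.projMap T) g ∧
        ∀ i, UniquenessMero.projMap T '' UniquenessMero.hyperplane (b (k i)) =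
          UniquenessMero.hyperplane (a (k i)) := by
  open UniquenessMero Matrix Topology in
  classical
  have hq1 : 3 * n + 2 ≤ q := by
    have := (le_max_left _ _).trans hq
    exact_mod_cast this
  have hq2 : 2 * N + 3 * n + 3 ≤ 2 * q := by
    have := (le_max_right _ _).trans hq
    have : 2 * (N : ℝ) + 3 * n + 3 ≤ 2 * q := by linarith
    exact_mod_cast this
  obtain ⟨ψ, hψ, hψ0, hloc⟩ := exists_entire_ratios (⟨0, by omega⟩ : Fin q) hf hg hfg
  have hrel : ∀ c : Fin q → ℂ, ∑ j, c j • a j = 0 →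
      ∀ z, ∑ j, c j * ψ j z * (b j ⬝ᵥ g.vec z) = 0 := by
    intro c hc z
    obtain ⟨F, G, hF, hG, u, hu⟩ := hloc z
    obtain ⟨hu0, hu⟩ := hu.self_of_nhds
    obtain ⟨d, hd, hGz⟩ := hG.eventually_eq_smul_vec.self_of_nhds
    have h1 : ∑ j, c j * (a j ⬝ᵥ F z) = 0 := by
      have := congrArg (· ⬝ᵥ F z) hc
      simpa [sum_dotProduct, smul_dotProduct] using this
    apply mul_left_cancel₀ (mul_ne_zero hu0 hd)
    rw [mul_zero, ← h1, Finset.mul_sum]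
    refine Finset.sum_congr rfl fun j _ => ?_
    rw [hu j, hGz, dotProduct_smul, smul_eq_mul]
    ring
  have hdet : ∀ r : Fin (n + 1) ⊕ Fin (N + 1) → Fin q, ∀ z,
      Matrix.det (Matrix.of fun i => leftRow (a (r i)) + ψ (r i) z • rightRow (b (r i))) = 0 := by
    intro r z
    -- The kernel vector may vanish where `F` does, so a nonzero determinant is first moved by
    -- continuity to a nearby point with `F ≠ 0`.
    by_contra hne
    obtain ⟨F, G, hF, hG, u, hu⟩ := hloc z
    have hcont : Continuous fun w => Matrix.det
        (Matrix.of fun i => leftRow (a (r i)) + ψ (r i) w • rightRow (b (r i))) := by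
      refine Continuous.matrix_det ?_
      refine continuous_pi fun i => ?_
      exact continuous_const.add ((hψ (r i)).continuous.smul continuous_const)
    obtain ⟨w, hFw, hdw, hu0, hw⟩ := (hF.frequently_ne_zero.and_eventually
      ((hcont.continuousAt.eventually_ne hne).and hu)).exists
    apply hdw
    rw [← Matrix.exists_mulVec_eq_zero_iff]
    refine ⟨Sum.elim (F w) (- (u w • G w)), fun h => hFw ?_, ?_⟩
    · funext i
      exact congrFun h (Sum.inl i)
    · funext i
      have := hw (r i)
      simp only [Matrix.mulVec, Matrix.of_apply, Pi.zero_apply, leftRow, rightRow, dotProduct,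
        Fintype.sum_sum_type, Pi.add_apply, Pi.smul_apply, Sum.elim_inl, Sum.elim_inr, smul_eq_mul,
        Pi.neg_apply, mul_zero, add_zero, zero_add] at this ⊢
      rw [this, Finset.mul_sum, ← Finset.sum_add_distrib]
      refine Finset.sum_eq_zero fun k _ => ?_
      ring
  obtain ⟨x, hxψ, hx⟩ := exists_exchange_valuation ha hb hψ hψ0 hdet
  obtain ⟨σ, hσ, hmono, h1, h2⟩ := exists_sorted_classes (by omega) hx
  have hclass : ∀ (S : Finset (Fin q)) k, (∀ j ∈ S, x j = x k) →
      ∃ γ : Fin q → ℂ, (∀ j ∈ S, γ j ≠ 0) ∧ ∀ j ∈ S, ∀ z, ψ j z = γ j * ψ k z := by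
    intro S k hS
    have : ∀ j, ∃ γ : ℂ, j ∈ S → γ ≠ 0 ∧ ∀ z, ψ j z = γ * ψ k z := by
      intro j
      by_cases hj : j ∈ S
      · obtain ⟨γ, h⟩ := hxψ j k (hS j hj)
        exact ⟨γ, fun _ => h⟩
      · exact ⟨0, fun h => absurd h hj⟩
    choose γ hγ using this
    exact ⟨γ, fun j hj => (hγ j hj).1, fun j hj => (hγ j hj).2⟩
  have hlin : ∀ v, (∀ z, v ⬝ᵥ g.vec z = 0) → v = 0 := fun v hv => hdeg.linear hv
  rcases hnN.eq_or_lt with rfl | hlt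
  · refine ⟨rfl, ?_⟩
    -- The block has `q - 2n ≥ n + 2` positions since `q ≥ 3n + 2`.
    obtain ⟨S, hS, hSx⟩ := exists_class_of_sorted (k := n + 2) hσ hmono (by omega) h1 (by omega)
    obtain ⟨γ, hγ0, hγ⟩ := hclass S _ hSx
    obtain ⟨T, hT, hinj⟩ := exists_linearEquiv_of_class ha hb hψ0 hrel hlin hS hγ0 hγ
    let e := (Finset.equivFinOfCardEq hS).symm
    refine ⟨T, fun i => e i, fun i j hij => e.injective (Subtype.ext hij),
      eqComp_of_linearEquiv hψ0 hloc hγ T hT hinj, fun i => ?_⟩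
    exact projMap_image_hyperplane T (hγ0 _ (e i).2) (hT _ (e i).2)
  · exfalso
    -- When the two block values agree, the blocks merge into positions `n, …, q - n - 1`, again at
    -- least `n + 2` of them.
    by_cases hxx : x (σ N) ≤ x (σ n)
    · obtain ⟨S, hS, hSx⟩ := exists_class_of_sorted (k := n + 2) hσ hmono (by omega)
        (h1.trans hxx) (by omega)
      obtain ⟨γ, hγ0, hγ⟩ := hclass S _ hSx
      exact not_proportional_of_lt ha hb hlt hψ0 hrel hlin hS hγ0 hγ
    -- Each block has `q - n - N ≥ (n + 3) / 2` positions, as a real bound. Rounding up gives `(n +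
    -- 4) / 2` in natural-number division; this and its complement in `n + 3` are at least `2`
    -- because `n ≥ 1`.
    · obtain ⟨S₁, hS₁, hSx₁⟩ := exists_class_of_sorted (k := (n + 4) / 2) hσ hmono (by omega)
        h1 (by omega)
      obtain ⟨S₂, hS₂, hSx₂⟩ := exists_class_of_sorted (k := n + 3 - (n + 4) / 2) hσ hmono
        (by omega) h2 (by omega)
      obtain ⟨γ₁, hγ0₁, hγ₁⟩ := hclass S₁ _ hSx₁
      obtain ⟨γ₂, hγ0₂, hγ₂⟩ := hclass S₂ _ hSx₂
      have hdisj : ∀ j ∈ S₂, j ∉ S₁ := fun j hj₂ hj₁ =>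
        hxx ((hSx₁ j hj₁).symm.trans (hSx₂ j hj₂)).le
      let γ : Fin q → ℂ := fun j => if j ∈ S₁ then γ₁ j else γ₂ j
      have e₁ : ∀ j ∈ S₁, γ j = γ₁ j := fun j hj => if_pos hj
      have e₂ : ∀ j ∈ S₂, γ j = γ₂ j := fun j hj => if_neg (hdisj j hj)
      refine not_two_proportional_classes (γ := γ) ha hb hlt hψ0 hrel hdeg.quadratic
        (Finset.disjoint_right.mpr fun j => hdisj j) (by omega) (by omega) (by omega)
        (fun j hj => ?_) (fun j hj => by rw [e₁ j hj]; exact hγ₁ j hj)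
        (fun j hj => by rw [e₂ j hj]; exact hγ₂ j hj)
      rcases Finset.mem_union.mp hj with hj | hj
      · rw [e₁ j hj]; exact hγ0₁ j hj
      · rw [e₂ j hj]; exact hγ0₂ j hj
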